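/- Let $\mathcal H_A,\mathcal H_B,\mathcal H_C$ be finite-dimensional complex Hilbert spaces and let $\rho_{ABC}$ be a density operator (positive semi-definite, trace one) on $\mathcal H_A\otimes\mathcal H_B\otimes\mathcal H_C$, with marginals $\rho_{AC},\rho_{BC},\rho_C$ obtained by partial trace. No invertibility is assumed: powers of a positive semi-definite operator are taken on its support, i.e. $H^r=\sum_{i:\lambda_i\neq 0}\lambda_i^r|i\rangle\langle i|$ for an eigendecomposition $H=\sum_i\lambda_i|i\rangle\langle i|$ and all real $r$ (so $H^0$ is the projection onto the support). Identity tensor factors are omitted. For $0<p<\infty$ let $\|X\|_p=(\operatorname{Tr}|X|^p)^{1/p}$ with $|X|=\sqrt{X^\dagger X}$, let $\|X\|_\infty$ be the operator norm, and let $\log$ be the natural logarithm with $\log 0=-\infty$. Define $$I'_\alpha(A;B|C)_\rho=\frac{2}{\alpha-1}\max_{V_{\rho_{AC}},V_{\rho_C}}\log\left\|\rho_{BC}^{(1-\alpha)/2}V_{\rho_C}\rho_C^{(\alpha-1)/2}\rho_{AC}^{(1-\alpha)/2}V_{\rho_{AC}}\rho_{ABC}^{\alpha/2}\right\|_2$$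 for real $\alpha\ge 0$, $\alpha\ne1$, and $$\widetilde I'_\alpha(A;B|C)_\rho=\frac{2}{\alpha'}\max_{V_{\rho_{AC}},V_{\rho_C}}\log\left\|\rho_{BC}^{-\alpha'/2}V_{\rho_C}\rho_C^{\alpha'/2}\rho_{AC}^{-\alpha'/2}V_{\rho_{AC}}\rho_{ABC}^{1/2}\right\|_{2\alpha},\qquad \alpha'=\frac{\alpha-1}{\alpha},$$ for $\alpha\in(0,1)\cup(1,\infty]$, with $\alpha'=1$ and $2\alpha=\infty$ when $\alpha=\infty$. Here the maxima are over all unitaries $V_{\rho_{AC}}$ on $\mathcal H_A\otimes\mathcal H_C$ commuting with $\rho_{AC}$ and all unitaries $V_{\rho_C}$ on $\mathcal H_C$ commuting with $\rho_C$. Then both quantities are monotone non-decreasing in the Rényi parameter: for all real $\alpha,\gamma$ with $0\le\alpha\le\gamma\le2$, $\alpha\neq1$, $\gamma\neq1$, $$I'_\alpha(A;B|C)_\rho\le I'_\gamma(A;B|C)_\rho,$$ and for all $\alpha,\gamma$ with $1/2\le\alpha\le\gamma\le\infty$, $\alpha\neq1$, $\gamma\neq1$, $$\widetilde I'_\alpha(A;B|C)_\rho\le\widetilde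 I'_\gamma(A;B|C)_\rho .$$ -/

import Mathlib

open scoped ENNReal Kronecker ComplexOrder

noncomputable section

namespace SwiveledRenyi

section General

variable {n : Type*} [Fintype n] [DecidableEq n]

/-- A density operator: a positive semi-definite matrix of trace one. -/
def IsDensityOperator (ρ : Matrix n n ℂ) : Prop :=
  ρ.PosSemidef ∧ ρ.trace = 1

/-- The real power `H ^ r` of a positive semi-definite matrix, evaluated on the support of `H`:
an eigenvalue `x ≠ 0` becomes `x ^ r`, while the kernel is kept (for every `r`, also `r ≤ 0`).
In particular `suppPow H 0` is the projection onto the support of `H`. -/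
def suppPow (H : Matrix n n ℂ) (r : ℝ) : Matrix n n ℂ :=
  cfc (fun x : ℝ => if x = 0 then 0 else x ^ r) H

/-- The absolute value `|X| = √(Xᴴ X)`. -/
def matAbs (X : Matrix n n ℂ) : Matrix n n ℂ :=
  suppPow (X.conjTranspose * X) (1 / 2)

/-- The Schatten norm: `‖X‖_p = (Tr |X| ^ p) ^ (1 / p)` for finite `p > 0`,
and the operator norm on the Hilbert space `ℂⁿ` for `p = ∞`. -/
def schattenNorm (p : ℝ≥0∞) (X : Matrix n n ℂ) : ℝ :=
  if p = ∞ then ‖Matrix.toEuclideanCLM (𝕜 := ℂ) X‖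
  else ((suppPow (matAbs X) p.toReal).trace.re) ^ (1 / p.toReal)

/-- The extended-real logarithm of the Schatten norm (`-∞` if the matrix is zero). -/
def logSchattenNorm (p : ℝ≥0∞) (X : Matrix n n ℂ) : EReal :=
  ENNReal.log (ENNReal.ofReal (schattenNorm p X))

/-- The set of all unitaries commuting with `ω`. -/
def swivels (ω : Matrix n n ℂ) : Set (Matrix n n ℂ) :=
  {V | V ∈ Matrix.unitaryGroup n ℂ ∧ Commute V ω}

end General

section Tripartite

variable {A B C : Type*} [Fintype A] [Fintype B] [Fintype C]
  [DecidableEq A] [DecidableEq B] [DecidableEq C]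

/-- The marginal on `AC`: partial trace over `B`. -/
def margAC (ρ : Matrix (A × B × C) (A × B × C) ℂ) : Matrix (A × C) (A × C) ℂ :=
  Matrix.of fun i j => ∑ b : B, ρ (i.1, b, i.2) (j.1, b, j.2)

/-- The marginal on `BC`: partial trace over `A`. -/
def margBC (ρ : Matrix (A × B × C) (A × B × C) ℂ) : Matrix (B × C) (B × C) ℂ :=
  Matrix.of fun i j => ∑ a : A, ρ (a, i) (a, j)

/-- The marginal on `C`: partial trace over `A` and `B`. -/
def margC (ρ : Matrix (A × B × C) (A × B × C) ℂ) : Matrix C C ℂ :=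
  Matrix.of fun i j => ∑ a : A, ∑ b : B, ρ (a, b, i) (a, b, j)

/-- An operator on `AC`, tensored with the identity on `B`. -/
def liftAC (X : Matrix (A × C) (A × C) ℂ) : Matrix (A × B × C) (A × B × C) ℂ :=
  Matrix.of fun i j => if i.2.1 = j.2.1 then X (i.1, i.2.2) (j.1, j.2.2) else 0

/-- An operator on `BC`, tensored with the identity on `A`. -/
def liftBC (X : Matrix (B × C) (B × C) ℂ) : Matrix (A × B × C) (A × B × C) ℂ :=
  (1 : Matrix A A ℂ) ⊗ₖ X

/-- An operator on `C`, tensored with the identity on `A` and `B`. -/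
def liftC (X : Matrix C C ℂ) : Matrix (A × B × C) (A × B × C) ℂ :=
  (1 : Matrix A A ℂ) ⊗ₖ ((1 : Matrix B B ℂ) ⊗ₖ X)

/-- The operator chain `ρ_BC^(-s/2) W ρ_C^(s/2) ρ_AC^(-s/2) V ρ_ABC^t`, where `V` acts on `AC`
and `W` on `C`. -/
def chain (ρ : Matrix (A × B × C) (A × B × C) ℂ) (s t : ℝ)
    (V : Matrix (A × C) (A × C) ℂ) (W : Matrix C C ℂ) : Matrix (A × B × C) (A × B × C) ℂ :=
  liftBC (suppPow (margBC ρ) (-s / 2)) * liftC W * liftC (suppPow (margC ρ) (s / 2)) *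
    liftAC (suppPow (margAC ρ) (-s / 2)) * liftAC V * suppPow ρ t

/-- The swiveled Rényi conditional mutual information `I'_α(A;B|C)_ρ`. -/
def renyiCMI (ρ : Matrix (A × B × C) (A × B × C) ℂ) (α : ℝ) : EReal :=
  ((2 / (α - 1) : ℝ) : EReal) *
    ⨆ V ∈ swivels (margAC ρ), ⨆ W ∈ swivels (margC ρ),
      logSchattenNorm 2 (chain ρ (α - 1) (α / 2) V W)

/-- `α' = (α - 1) / α`, equal to `1` at `α = ∞`. -/
def primeExponent (α : ℝ≥0∞) : ℝ :=
  if α = ∞ then 1 else (α.toReal - 1) / α.toReal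

/-- The sandwiched swiveled Rényi conditional mutual information `Ĩ'_α(A;B|C)_ρ`. -/
def sandwichedRenyiCMI (ρ : Matrix (A × B × C) (A × B × C) ℂ) (α : ℝ≥0∞) : EReal :=
  ((2 / primeExponent α : ℝ) : EReal) *
    ⨆ V ∈ swivels (margAC ρ), ⨆ W ∈ swivels (margC ρ),
      logSchattenNorm (2 * α) (chain ρ (primeExponent α) (1 / 2) V W)

end Tripartite

end SwiveledRenyi

end

/-! Put `s = α - 1` in the plain case and `s = α'` in the sandwiched case; both parameter ranges
land in `[-1, 1]`, and `α ↦ s` is increasing. Each quantity equals `2 * log f(s) / s`, where `f =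
lineSup` is the supremum over the swivels of a Schatten norm of the chain, whose operator exponents
and reciprocal Schatten exponent are affine in `s`. Two facts suffice. First, `f(0) = 1`
(`lineSup_zero`): at `s = 0` only contractions act on `√ρ`, and with trivial swivels they fix it.
Second, `log f` is convex on `[-1, 1]` (`convexOn_log_lineSup`). Hence `log f(s) / s` is the slope
of the secant of a convex function from `0`, which is non-decreasing (`log_lineSup_div_le`).

Convexity is Stein interpolation (`recipSchattenNorm_interpolation`). Let the exponents run through
a complex strip. On a boundary line, the imaginary parts contribute unitaries commuting with the
respective operators. Those from `ρ_AC` and `ρ_C` sit inside the chain and are absorbed by the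
optimisation over swivels; those from `ρ_BC` and `ρ` sit at the two ends and do no harm to the norm
(`exists_complexChain_eq`). Interpolation itself combines the three lines theorem with a Hölder
inequality for traces (`norm_trace_mul_hfn_le`), applied to the pairing of the chain with a dual
family built from its polar decomposition at the interpolated point. -/

open scoped ENNReal Kronecker ComplexOrder

noncomputable section

set_option linter.unusedSectionVars false

namespace SwiveledRenyi

open Matrix
open scoped Matrix.Norms.L2Operator

/-! ### Spectral calculus with complex powers on the support -/

section SpectralCalculus

variable {n : Type*} [Fintype n] [DecidableEq n] {H : Matrix n n ℂ}

/-- The spectral calculus of a Hermitian matrix for complex-valued functions. -/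
def hfn (hH : H.IsHermitian) (g : ℝ → ℂ) : Matrix n n ℂ :=
  (hH.eigenvectorUnitary : Matrix n n ℂ) * diagonal (fun i => g (hH.eigenvalues i)) *
    (hH.eigenvectorUnitary : Matrix n n ℂ)ᴴ

theorem eigenvectorUnitary_conjTranspose_mul (hH : H.IsHermitian) :
    (hH.eigenvectorUnitary : Matrix n n ℂ)ᴴ * (hH.eigenvectorUnitary : Matrix n n ℂ) = 1 :=
  Unitary.coe_star_mul_self _

theorem eigenvectorUnitary_mul_conjTranspose (hH : H.IsHermitian) :
    (hH.eigenvectorUnitary : Matrix n n ℂ) * (hH.eigenvectorUnitary : Matrix n n ℂ)ᴴ = 1 :=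
  Unitary.coe_mul_star_self _

theorem hfn_mul (hH : H.IsHermitian) (g h : ℝ → ℂ) :
    hfn hH g * hfn hH h = hfn hH (fun x => g x * h x) := by
  have key : ∀ U D E V : Matrix n n ℂ, V * U = 1 →
      (U * D * V) * (U * E * V) = U * (D * E) * V := by
    intro U D E V h
    calc (U * D * V) * (U * E * V) = U * D * (V * U) * E * V := by simp only [Matrix.mul_assoc]
      _ = _ := by rw [h]; simp only [Matrix.mul_assoc, Matrix.mul_one]
  rw [hfn, hfn, key _ _ _ _ (eigenvectorUnitary_conjTranspose_mul hH), diagonal_mul_diagonal, hfn]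

theorem hfn_conjTranspose (hH : H.IsHermitian) (g : ℝ → ℂ) :
    (hfn hH g)ᴴ = hfn hH (fun x => star (g x)) := by
  simp only [hfn, conjTranspose_mul, conjTranspose_conjTranspose, diagonal_conjTranspose,
    Matrix.mul_assoc]
  rfl

theorem hfn_congr (hH : H.IsHermitian) {g h : ℝ → ℂ}
    (hgh : ∀ i, g (hH.eigenvalues i) = h (hH.eigenvalues i)) : hfn hH g = hfn hH h := by
  simp only [hfn, hgh]

theorem hfn_one (hH : H.IsHermitian) : hfn hH (fun _ => 1) = 1 := by
  rw [hfn, diagonal_one, Matrix.mul_one, eigenvectorUnitary_mul_conjTranspose]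

theorem hfn_ofReal (hH : H.IsHermitian) : hfn hH (fun x => (x : ℂ)) = H := by
  conv_rhs => rw [hH.spectral_theorem, Unitary.conjStarAlgAut_apply]
  rfl

theorem cfc_eq_hfn (hH : H.IsHermitian) (f : ℝ → ℝ) :
    cfc f H = hfn hH (fun x => (f x : ℂ)) := by
  rw [hH.cfc_eq, IsHermitian.cfc, Unitary.conjStarAlgAut_apply]
  rfl

theorem trace_hfn (hH : H.IsHermitian) (g : ℝ → ℂ) :
    (hfn hH g).trace = ∑ i, g (hH.eigenvalues i) := by
  rw [hfn, Matrix.trace_mul_comm, ← Matrix.mul_assoc, eigenvectorUnitary_conjTranspose_mul,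
    Matrix.one_mul, trace_diagonal]

theorem norm_le_one_of_conjTranspose_mul {U : Matrix n n ℂ} (hU : Uᴴ * U = 1) : ‖U‖ ≤ 1 := by
  have h := l2_opNorm_conjTranspose_mul_self U
  have h1 : ‖(1 : Matrix n n ℂ)‖ ≤ 1 := by
    rw [← diagonal_one, l2_opNorm_diagonal]
    exact (pi_norm_le_iff_of_nonneg zero_le_one).2 fun i => by simp
  rw [hU] at h
  nlinarith [norm_nonneg U]

theorem norm_le_one_of_mem_unitaryGroup {U : Matrix n n ℂ} (hU : U ∈ unitaryGroup n ℂ) :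
    ‖U‖ ≤ 1 :=
  norm_le_one_of_conjTranspose_mul (mem_unitaryGroup_iff'.1 hU)

theorem norm_mul_le_one {X Y : Matrix n n ℂ} (hX : ‖X‖ ≤ 1) (hY : ‖Y‖ ≤ 1) : ‖X * Y‖ ≤ 1 :=
  (norm_mul_le _ _).trans (mul_le_one₀ hX (norm_nonneg _) hY)

theorem norm_le_one_of_projection {P : Matrix n n ℂ} (hP : Pᴴ = P) (hPP : P * P = P) :
    ‖P‖ ≤ 1 := by
  have h := l2_opNorm_conjTranspose_mul_self P
  rw [hP, hPP] at h
  by_contra! hlt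
  nlinarith

theorem hfn_mem_unitaryGroup (hH : H.IsHermitian) {g : ℝ → ℂ} (hg : ∀ x, ‖g x‖ = 1) :
    hfn hH g ∈ unitaryGroup n ℂ := by
  rw [mem_unitaryGroup_iff', star_eq_conjTranspose, hfn_conjTranspose, hfn_mul, ← hfn_one hH]
  refine hfn_congr hH fun i => ?_
  rw [Complex.star_def, ← Complex.normSq_eq_conj_mul_self, Complex.normSq_eq_norm_sq, hg]
  norm_num

theorem hfn_commute (hH : H.IsHermitian) (g : ℝ → ℂ) : Commute (hfn hH g) H := by
  conv_rhs => rw [← hfn_ofReal hH]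
  rw [Commute, SemiconjBy, hfn_mul, hfn_mul]
  exact hfn_congr hH fun i => mul_comm _ _

theorem norm_hfn_le (hH : H.IsHermitian) {g : ℝ → ℂ} {r : ℝ} (hr : 0 ≤ r)
    (hg : ∀ i, ‖g (hH.eigenvalues i)‖ ≤ r) : ‖hfn hH g‖ ≤ r := by
  have hU := norm_le_one_of_mem_unitaryGroup hH.eigenvectorUnitary.2
  have hV : ‖(hH.eigenvectorUnitary : Matrix n n ℂ)ᴴ‖ ≤ 1 := by
    rwa [l2_opNorm_conjTranspose]
  have hD : ‖(diagonal (fun i => g (hH.eigenvalues i)) : Matrix n n ℂ)‖ ≤ r := by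
    rw [l2_opNorm_diagonal]
    exact (pi_norm_le_iff_of_nonneg hr).2 hg
  calc ‖hfn hH g‖ ≤ 1 * r * 1 := by
        refine (norm_mul_le _ _).trans ?_
        gcongr
        refine (norm_mul_le _ _).trans ?_
        gcongr
    _ = r := by ring

/-- The power function `x ^ w` on the support, for a complex exponent. -/
def suppCpow (w : ℂ) (x : ℝ) : ℂ :=
  if x = 0 then 0 else Complex.exp (Real.log x * w)

theorem suppCpow_ofReal {x : ℝ} (hx : 0 ≤ x) (r : ℝ) :
    suppCpow r x = ((if x = 0 then 0 else x ^ r : ℝ) : ℂ) := by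
  unfold suppCpow
  split_ifs with h
  · simp
  · rw [Real.rpow_def_of_pos (lt_of_le_of_ne hx (Ne.symm h))]
    push_cast
    rfl

theorem suppCpow_add (w v : ℂ) (x : ℝ) : suppCpow (w + v) x = suppCpow w x * suppCpow v x := by
  unfold suppCpow
  split_ifs
  · simp
  · rw [mul_add, Complex.exp_add]

theorem norm_suppCpow {x : ℝ} (hx : 0 ≤ x) (w : ℂ) :
    ‖suppCpow w x‖ = if x = 0 then 0 else x ^ w.re := by
  unfold suppCpow
  split_ifs with h
  · simp
  · rw [Complex.norm_exp, Real.rpow_def_of_pos (lt_of_le_of_ne hx (Ne.symm h))]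
    simp

theorem suppPow_eq_hfn (hH : H.PosSemidef) (r : ℝ) :
    suppPow H r = hfn hH.1 (suppCpow r) := by
  rw [suppPow, cfc_eq_hfn hH.1]
  exact hfn_congr _ fun i => (suppCpow_ofReal (hH.eigenvalues_nonneg i) r).symm

theorem suppPow_conjTranspose (hH : H.PosSemidef) (r : ℝ) : (suppPow H r)ᴴ = suppPow H r := by
  rw [suppPow_eq_hfn hH, hfn_conjTranspose]
  refine hfn_congr _ fun i => ?_
  rw [suppCpow_ofReal (hH.eigenvalues_nonneg i)]
  simp

theorem suppPow_mul (hH : H.PosSemidef) (r s : ℝ) :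
    suppPow H r * suppPow H s = suppPow H (r + s) := by
  rw [suppPow_eq_hfn hH, suppPow_eq_hfn hH, suppPow_eq_hfn hH, hfn_mul]
  refine hfn_congr _ fun i => ?_
  rw [← suppCpow_add]
  push_cast
  rfl

theorem suppPow_one (hH : H.PosSemidef) : suppPow H 1 = H := by
  conv_rhs => rw [← hfn_ofReal hH.1]
  rw [suppPow_eq_hfn hH]
  refine hfn_congr _ fun i => ?_
  rw [suppCpow_ofReal (hH.eigenvalues_nonneg i)]
  split_ifs with h <;> simp [h]

/-- Valid for all real exponents: `0` is sent to `0`, and a positive eigenvalue stays positive, so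
the support never changes. -/
theorem suppPow_suppPow (hH : H.PosSemidef) (r s : ℝ) :
    suppPow (suppPow H r) s = suppPow H (r * s) := by
  have hsa : IsSelfAdjoint H := hH.1
  have h : ∀ s : Set ℝ, s.Finite → ∀ f : ℝ → ℝ, ContinuousOn f s := fun s hs f =>
    Set.Finite.continuousOn hs f
  unfold suppPow
  rw [← cfc_comp _ _ H hsa (h _ (H.finite_real_spectrum.image _) _) (h _ H.finite_real_spectrum _)]
  refine cfc_congr fun x hx => ?_
  have hx0 : 0 ≤ x := by
    rw [hH.1.spectrum_real_eq_range_eigenvalues] at hx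
    obtain ⟨i, rfl⟩ := hx
    exact hH.eigenvalues_nonneg i
  simp only [Function.comp_apply]
  by_cases hx1 : x = 0
  · simp [hx1]
  · have : x ^ r ≠ 0 := (Real.rpow_pos_of_pos (lt_of_le_of_ne hx0 (Ne.symm hx1)) r).ne'
    simp [hx1, this, Real.rpow_mul hx0]

/-- At `r = 0` the two sides would differ on the kernel, since `0 ^ 0 = 1` for real powers while the
support power gives `0`. -/
theorem trace_suppPow_re (hH : H.PosSemidef) {r : ℝ} (hr : r ≠ 0) :
    (suppPow H r).trace.re = ∑ i, hH.1.eigenvalues i ^ r := by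
  rw [suppPow_eq_hfn hH, trace_hfn, Complex.re_sum]
  refine Finset.sum_congr rfl fun i _ => ?_
  rw [suppCpow_ofReal (hH.eigenvalues_nonneg i), Complex.ofReal_re]
  split_ifs with h
  · rw [h, Real.zero_rpow hr]
  · rfl

/-! ### Polar decomposition -/

/-- The partial isometry in the polar decomposition of `X`. -/
def polarPart (X : Matrix n n ℂ) : Matrix n n ℂ :=
  X * hfn (isHermitian_conjTranspose_mul_self X) (suppCpow (-1 / 2))

theorem eigenvalues_gram_nonneg (X : Matrix n n ℂ) (i : n) :
    0 ≤ (isHermitian_conjTranspose_mul_self X).eigenvalues i :=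
  (posSemidef_conjTranspose_mul_self X).eigenvalues_nonneg i

theorem star_suppCpow_ofReal {x : ℝ} (hx : 0 ≤ x) (r : ℝ) :
    star (suppCpow r x) = suppCpow r x := by
  rw [suppCpow_ofReal hx]
  simp

theorem ofReal_eq_suppCpow_one {x : ℝ} (hx : 0 ≤ x) : (x : ℂ) = suppCpow 1 x := by
  have := suppCpow_ofReal hx 1
  rw [Complex.ofReal_one] at this
  rw [this]
  split_ifs with h <;> simp [h]

theorem gram_eq_hfn (X : Matrix n n ℂ) :
    hfn (isHermitian_conjTranspose_mul_self X) (suppCpow 1) = Xᴴ * X := by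
  conv_rhs => rw [← hfn_ofReal (isHermitian_conjTranspose_mul_self X)]
  exact hfn_congr _ fun i => (ofReal_eq_suppCpow_one (eigenvalues_gram_nonneg X i)).symm

theorem polarPart_conjTranspose (X : Matrix n n ℂ) : (polarPart X)ᴴ =
    hfn (isHermitian_conjTranspose_mul_self X) (suppCpow (-1 / 2)) * Xᴴ := by
  rw [polarPart, conjTranspose_mul, hfn_conjTranspose]
  congr 1
  refine hfn_congr _ fun i => ?_
  have := star_suppCpow_ofReal (eigenvalues_gram_nonneg X i) (-1 / 2)
  push_cast at this
  exact this

theorem hfn_suppCpow_mul (hH : H.IsHermitian) (w v : ℂ) :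
    hfn hH (suppCpow w) * hfn hH (suppCpow v) = hfn hH (suppCpow (w + v)) := by
  rw [hfn_mul]
  exact hfn_congr _ fun i => (suppCpow_add _ _ _).symm

theorem hfn_suppCpow_mul_gram (X : Matrix n n ℂ) (w : ℂ) :
    hfn (isHermitian_conjTranspose_mul_self X) (suppCpow w) * (Xᴴ * X) =
      hfn (isHermitian_conjTranspose_mul_self X) (suppCpow (w + 1)) := by
  rw [← hfn_suppCpow_mul, gram_eq_hfn]

theorem gram_mul_hfn_suppCpow (X : Matrix n n ℂ) (w : ℂ) :
    Xᴴ * X * hfn (isHermitian_conjTranspose_mul_self X) (suppCpow w) =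
      hfn (isHermitian_conjTranspose_mul_self X) (suppCpow (1 + w)) := by
  rw [← hfn_suppCpow_mul, gram_eq_hfn]

theorem polarPart_conjTranspose_mul (X : Matrix n n ℂ) : (polarPart X)ᴴ * X =
    hfn (isHermitian_conjTranspose_mul_self X) (suppCpow (1 / 2)) := by
  rw [polarPart_conjTranspose, Matrix.mul_assoc, hfn_suppCpow_mul_gram]
  congr 2
  norm_num

/-- For `W = polarPart X`, the product `Wᴴ W` is the support projection of `Xᴴ X`. -/
theorem norm_polarPart_le_one (X : Matrix n n ℂ) : ‖polarPart X‖ ≤ 1 := by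
  have h : (polarPart X)ᴴ * polarPart X =
      hfn (isHermitian_conjTranspose_mul_self X) (suppCpow 0) := by
    conv_lhs => rw [polarPart, ← Matrix.mul_assoc, ← polarPart, polarPart_conjTranspose_mul,
      hfn_suppCpow_mul]
    norm_num
  have h1 := l2_opNorm_conjTranspose_mul_self (polarPart X)
  have h2 : ‖(polarPart X)ᴴ * polarPart X‖ ≤ 1 := by
    rw [h]
    refine norm_hfn_le _ zero_le_one fun i => ?_
    rw [norm_suppCpow (eigenvalues_gram_nonneg X i)]
    split_ifs <;> simp
  rw [h1] at h2
  by_contra! hlt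
  nlinarith

/-- For the support projection `P` of `Xᴴ X`, the four terms of `(XP - X)ᴴ (XP - X)` are all `± Xᴴ
X` and cancel. -/
theorem mul_hfn_suppCpow_zero (X : Matrix n n ℂ) :
    X * hfn (isHermitian_conjTranspose_mul_self X) (suppCpow 0) = X := by
  set hH := isHermitian_conjTranspose_mul_self X
  have hP : (hfn hH (suppCpow 0))ᴴ = hfn hH (suppCpow 0) := by
    rw [hfn_conjTranspose]
    refine hfn_congr _ fun i => ?_
    simpa using star_suppCpow_ofReal (eigenvalues_gram_nonneg X i) 0
  have h : (X * hfn hH (suppCpow 0) - X)ᴴ * (X * hfn hH (suppCpow 0) - X) = 0 := by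
    rw [conjTranspose_sub, conjTranspose_mul, hP, Matrix.sub_mul, Matrix.mul_sub, Matrix.mul_sub]
    have e1 : hfn hH (suppCpow 0) * Xᴴ * X = Xᴴ * X := by
      rw [Matrix.mul_assoc, hfn_suppCpow_mul_gram, zero_add, gram_eq_hfn]
    have e2 : Xᴴ * X * hfn hH (suppCpow 0) = Xᴴ * X := by
      rw [gram_mul_hfn_suppCpow, add_zero, gram_eq_hfn]
    rw [← Matrix.mul_assoc, ← Matrix.mul_assoc, e1, e2]
    simp
  exact sub_eq_zero.1 (conjTranspose_mul_self_eq_zero.1 h)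

theorem polarPart_mul (X : Matrix n n ℂ) :
    polarPart X * hfn (isHermitian_conjTranspose_mul_self X) (suppCpow (1 / 2)) = X := by
  rw [polarPart, Matrix.mul_assoc, hfn_suppCpow_mul]
  norm_num
  exact mul_hfn_suppCpow_zero X

end SpectralCalculus

/-! ### Hölder's inequality for traces -/

section Holder

variable {n : Type*} [Fintype n]

/-- Hölder's inequality with doubly substochastic weights, for conjugate exponents `1 / c` and
`1 / (1 - c)`, the endpoints included. -/
theorem sum_mul_rpow_le {S : n → n → ℝ} (hS : ∀ i j, 0 ≤ S i j) (hrow : ∀ i, ∑ j, S i j ≤ 1)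
    (hcol : ∀ j, ∑ i, S i j ≤ 1) {a b : n → ℝ} (ha : ∀ i, 0 ≤ a i) (hb : ∀ j, 0 ≤ b j)
    {c : ℝ} (hc0 : 0 ≤ c) (hc1 : c ≤ 1) :
    ∑ i, ∑ j, S i j * (a i ^ c * b j ^ (1 - c)) ≤ (∑ i, a i) ^ c * (∑ j, b j) ^ (1 - c) := by
  have hA : 0 ≤ ∑ i, a i := Finset.sum_nonneg fun i _ => ha i
  have hB : 0 ≤ ∑ j, b j := Finset.sum_nonneg fun j _ => hb j
  have hrow' : ∑ i, ∑ j, S i j * a i ≤ ∑ i, a i := by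
    refine Finset.sum_le_sum fun i _ => ?_
    rw [← Finset.sum_mul]
    exact mul_le_of_le_one_left (ha i) (hrow i)
  have hcol' : ∑ i, ∑ j, S i j * b j ≤ ∑ j, b j := by
    rw [Finset.sum_comm]
    refine Finset.sum_le_sum fun j _ => ?_
    rw [← Finset.sum_mul]
    exact mul_le_of_le_one_left (hb j) (hcol j)
  have hpos : 0 ≤ (∑ i, a i) ^ c * (∑ j, b j) ^ (1 - c) := by positivity
  -- The endpoints are separate because `0 ^ 0 = 1`: there one factor is constantly `1` and a single
  -- marginal bound suffices, while the vanishing-sum cases below need nonzero exponents.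
  rcases hc0.eq_or_lt with rfl | hc0'
  · simpa using hcol'
  rcases hc1.eq_or_lt with rfl | hc1'
  · simpa using hrow'
  rcases hA.eq_or_lt with hA0 | hA0
  · have h0 : ∀ i, a i = 0 := fun i =>
      (Finset.sum_eq_zero_iff_of_nonneg fun i _ => ha i).1 hA0.symm i (Finset.mem_univ i)
    refine le_trans (le_of_eq ?_) hpos
    simp [h0, Real.zero_rpow hc0'.ne']
  rcases hB.eq_or_lt with hB0 | hB0
  · have h0 : ∀ j, b j = 0 := fun j =>
      (Finset.sum_eq_zero_iff_of_nonneg fun i _ => hb i).1 hB0.symm j (Finset.mem_univ j)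
    refine le_trans (le_of_eq ?_) hpos
    simp [h0, Real.zero_rpow (sub_pos.2 hc1').ne']
  set P := ∑ i, a i
  set Q := ∑ j, b j
  have hPQ : 0 < P ^ c * Q ^ (1 - c) := by positivity
  have key : ∀ i j, S i j * (a i ^ c * b j ^ (1 - c)) ≤
      (P ^ c * Q ^ (1 - c)) * (c / P * (S i j * a i) + (1 - c) / Q * (S i j * b j)) := by
    intro i j
    -- Weighted AM-GM for the normalised entries `a i / P` and `b j / Q`; summed against `S`, the
    -- right side becomes at most `c + (1 - c) = 1`.
    have h := Real.geom_mean_le_arith_mean2_weighted hc0 (sub_nonneg.2 hc1)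
      (div_nonneg (ha i) hA) (div_nonneg (hb j) hB) (by ring)
    rw [Real.div_rpow (ha i) hA, Real.div_rpow (hb j) hB, div_mul_div_comm,
      div_le_iff₀ hPQ] at h
    calc S i j * (a i ^ c * b j ^ (1 - c))
        ≤ S i j * ((c * (a i / P) + (1 - c) * (b j / Q)) * (P ^ c * Q ^ (1 - c))) :=
          mul_le_mul_of_nonneg_left h (hS i j)
      _ = _ := by ring
  calc ∑ i, ∑ j, S i j * (a i ^ c * b j ^ (1 - c))
      ≤ ∑ i, ∑ j, (P ^ c * Q ^ (1 - c)) *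
          (c / P * (S i j * a i) + (1 - c) / Q * (S i j * b j)) :=
        Finset.sum_le_sum fun i _ => Finset.sum_le_sum fun j _ => key i j
    _ = (P ^ c * Q ^ (1 - c)) *
          (c / P * ∑ i, ∑ j, S i j * a i + (1 - c) / Q * ∑ i, ∑ j, S i j * b j) := by
        simp only [← Finset.mul_sum, Finset.sum_add_distrib]
    _ ≤ (P ^ c * Q ^ (1 - c)) * (c / P * P + (1 - c) / Q * Q) := by
        have : 0 ≤ 1 - c := sub_nonneg.2 hc1
        gcongr
    _ = P ^ c * Q ^ (1 - c) := by
        rw [div_mul_cancel₀ _ hA0.ne', div_mul_cancel₀ _ hB0.ne']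
        ring

variable [DecidableEq n] {H : Matrix n n ℂ}

theorem sum_col_norm_sq_le (K : Matrix n n ℂ) (j : n) : ∑ i, ‖K i j‖ ^ 2 ≤ ‖K‖ ^ 2 := by
  have h := l2_opNorm_mulVec K (EuclideanSpace.single j (1 : ℂ))
  rw [PiLp.norm_single, norm_one, mul_one] at h
  have h2 := pow_le_pow_left₀ (norm_nonneg _) h 2
  rw [EuclideanSpace.norm_sq_eq] at h2
  simpa using h2

theorem sum_row_norm_sq_le (K : Matrix n n ℂ) (i : n) : ∑ j, ‖K i j‖ ^ 2 ≤ ‖K‖ ^ 2 := by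
  have h := sum_col_norm_sq_le Kᴴ i
  rw [l2_opNorm_conjTranspose] at h
  simpa using h

theorem eigenvalues_le_norm (hH : H.IsHermitian) (i : n) : hH.eigenvalues i ≤ ‖H‖ := by
  have hU := norm_le_one_of_mem_unitaryGroup hH.eigenvectorUnitary.2
  have hV : ‖(hH.eigenvectorUnitary : Matrix n n ℂ)ᴴ‖ ≤ 1 := by
    rwa [l2_opNorm_conjTranspose]
  have hD : (diagonal (fun i => (hH.eigenvalues i : ℂ)) : Matrix n n ℂ) =
      (hH.eigenvectorUnitary : Matrix n n ℂ)ᴴ * H * (hH.eigenvectorUnitary : Matrix n n ℂ) := by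
    have h := hH.conjStarAlgAut_star_eigenvectorUnitary
    rw [Unitary.conjStarAlgAut_star_apply] at h
    exact h.symm
  have h : ‖(diagonal (fun i => (hH.eigenvalues i : ℂ)) : Matrix n n ℂ)‖ ≤ ‖H‖ := by
    rw [hD]
    calc _ ≤ 1 * ‖H‖ * 1 := by
          refine (norm_mul_le _ _).trans ?_
          gcongr
          refine (norm_mul_le _ _).trans ?_
          gcongr
      _ = ‖H‖ := by ring
  rw [l2_opNorm_diagonal] at h
  have h2 := norm_le_pi_norm (fun i => (hH.eigenvalues i : ℂ)) i
  rw [Complex.norm_real] at h2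
  exact (le_abs_self _).trans (h2.trans h)

/-- The Schatten norm of exponent `1 / c`, through the squared singular values; the operator norm
for `c = 0`. -/
def recipSchattenNorm (c : ℝ) (X : Matrix n n ℂ) : ℝ :=
  if c = 0 then ‖X‖
  else (∑ i, (isHermitian_conjTranspose_mul_self X).eigenvalues i ^ (1 / (2 * c))) ^ c

theorem recipSchattenNorm_nonneg (c : ℝ) (X : Matrix n n ℂ) : 0 ≤ recipSchattenNorm c X := by
  unfold recipSchattenNorm
  split_ifs
  · exact norm_nonneg X
  · exact Real.rpow_nonneg (Finset.sum_nonneg fun i _ =>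
      Real.rpow_nonneg (eigenvalues_gram_nonneg X i) _) _

/-- The trace is a double sum with weights `u i j * w j i`, and `|u i j| |w j i| ≤ (|u i j|² + |w j
i|²) / 2`. The right side is doubly substochastic because rows and columns of a contraction have
Euclidean norm at most `1`. The constant `m` carries the bound on `d` when `c = 0`, where `a` says
nothing. -/
theorem norm_trace_diagonal_mul_le {u w : Matrix n n ℂ} (hu : ‖u‖ ≤ 1) (hw : ‖w‖ ≤ 1)
    {d e : n → ℂ} {c : ℝ} (hc0 : 0 ≤ c) (hc1 : c ≤ 1) {a b : n → ℝ}
    (ha : ∀ i, 0 ≤ a i) (hb : ∀ i, 0 ≤ b i) {m : ℝ} (hm : 0 ≤ m)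
    (hd : ∀ i, ‖d i‖ ≤ m * a i ^ c) (he : ∀ i, ‖e i‖ ≤ b i ^ (1 - c)) :
    ‖(diagonal d * u * (diagonal e * w)).trace‖ ≤
      m * ((∑ i, a i) ^ c * (∑ i, b i) ^ (1 - c)) := by
  have htr : (diagonal d * u * (diagonal e * w)).trace =
      ∑ i, ∑ j, d i * u i j * (e j * w j i) := by
    rw [Matrix.trace]
    refine Finset.sum_congr rfl fun i _ => ?_
    rw [Matrix.diag_apply, Matrix.mul_apply]
    refine Finset.sum_congr rfl fun j _ => ?_
    rw [diagonal_mul, diagonal_mul]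
  let S : n → n → ℝ := fun i j => (‖u i j‖ ^ 2 + ‖w j i‖ ^ 2) / 2
  have hS : ∀ i j, 0 ≤ S i j := fun i j => by positivity
  have hu2 : ‖u‖ ^ 2 ≤ 1 := pow_le_one₀ (norm_nonneg _) hu
  have hw2 : ‖w‖ ^ 2 ≤ 1 := pow_le_one₀ (norm_nonneg _) hw
  have hrow : ∀ i, ∑ j, S i j ≤ 1 := fun i => by
    simp only [S, ← Finset.sum_div, Finset.sum_add_distrib]
    linarith [sum_row_norm_sq_le u i, sum_col_norm_sq_le w i]
  have hcol : ∀ j, ∑ i, S i j ≤ 1 := fun j => by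
    simp only [S, ← Finset.sum_div, Finset.sum_add_distrib]
    linarith [sum_col_norm_sq_le u j, sum_row_norm_sq_le w j]
  rw [htr]
  calc ‖∑ i, ∑ j, d i * u i j * (e j * w j i)‖
      ≤ ∑ i, ∑ j, ‖d i * u i j * (e j * w j i)‖ :=
        (norm_sum_le _ _).trans (Finset.sum_le_sum fun i _ => norm_sum_le _ _)
    _ ≤ ∑ i, ∑ j, m * (S i j * (a i ^ c * b j ^ (1 - c))) := by
        refine Finset.sum_le_sum fun i _ => Finset.sum_le_sum fun j _ => ?_
        have h1 : ‖u i j‖ * ‖w j i‖ ≤ S i j := by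
          simp only [S]
          nlinarith [sq_nonneg (‖u i j‖ - ‖w j i‖)]
        have h2 : ‖d i‖ * ‖e j‖ ≤ (m * a i ^ c) * b j ^ (1 - c) :=
          mul_le_mul (hd i) (he j) (norm_nonneg _) ((norm_nonneg _).trans (hd i))
        calc ‖d i * u i j * (e j * w j i)‖ = (‖d i‖ * ‖e j‖) * (‖u i j‖ * ‖w j i‖) := by
              simp only [norm_mul]
              ring
          _ ≤ ((m * a i ^ c) * b j ^ (1 - c)) * S i j :=
              mul_le_mul h2 h1 (by positivity) (le_trans (by positivity) h2)
          _ = _ := by ring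
    _ = m * ∑ i, ∑ j, S i j * (a i ^ c * b j ^ (1 - c)) := by simp only [← Finset.mul_sum]
    _ ≤ _ := mul_le_mul_of_nonneg_left (sum_mul_rpow_le hS hrow hcol ha hb hc0 hc1) hm

/-- Diagonalise `|G|` in `G = W |G|` and diagonalise the spectral function of `H`. By cyclicity of
the trace, the eigenbases, `W`, `K₁` and `K₂` merge into two contractions between the two diagonal
matrices. -/
theorem norm_trace_mul_hfn_le_of_le {G K₁ K₂ : Matrix n n ℂ} (hK₁ : ‖K₁‖ ≤ 1) (hK₂ : ‖K₂‖ ≤ 1)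
    (hH : H.IsHermitian) {g : ℝ → ℂ} {c : ℝ} (hc0 : 0 ≤ c) (hc1 : c ≤ 1) {a b : n → ℝ}
    (ha : ∀ i, 0 ≤ a i) (hb : ∀ i, 0 ≤ b i) {m : ℝ} (hm : 0 ≤ m)
    (hGa : ∀ i, (isHermitian_conjTranspose_mul_self G).eigenvalues i ^ (1 / 2 : ℝ) ≤ m * a i ^ c)
    (hg : ∀ i, ‖g (hH.eigenvalues i)‖ ≤ b i ^ (1 - c)) :
    ‖(G * K₁ * hfn hH g * K₂).trace‖ ≤ m * ((∑ i, a i) ^ c * (∑ i, b i) ^ (1 - c)) := by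
  have nU := norm_le_one_of_mem_unitaryGroup
    (isHermitian_conjTranspose_mul_self G).eigenvectorUnitary.2
  have nV := norm_le_one_of_mem_unitaryGroup hH.eigenvectorUnitary.2
  have hGW := polarPart_mul G
  have nW := norm_polarPart_le_one G
  have hd : ∀ i, ‖suppCpow (1 / 2) ((isHermitian_conjTranspose_mul_self G).eigenvalues i)‖ ≤
      m * a i ^ c := fun i => by
    refine le_trans (le_of_eq ?_) (hGa i)
    rw [norm_suppCpow (eigenvalues_gram_nonneg G i)]
    split_ifs with h
    · rw [h, Real.zero_rpow (by norm_num)]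
    · norm_num
  rw [hfn] at hGW ⊢
  generalize ((isHermitian_conjTranspose_mul_self G).eigenvectorUnitary : Matrix n n ℂ) = U at *
  generalize (hH.eigenvectorUnitary : Matrix n n ℂ) = V at *
  generalize polarPart G = W at *
  generalize hde : (fun i => suppCpow (1 / 2)
    ((isHermitian_conjTranspose_mul_self G).eigenvalues i)) = d at *
  generalize hee : (fun i => g (hH.eigenvalues i)) = e at *
  replace hd : ∀ i, ‖d i‖ ≤ m * a i ^ c := fun i => by simpa only [← hde] using hd i
  replace hg : ∀ i, ‖e i‖ ≤ b i ^ (1 - c) := fun i => by simpa only [← hee] using hg i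
  have nU' : ‖Uᴴ‖ ≤ 1 := by rwa [l2_opNorm_conjTranspose]
  have nV' : ‖Vᴴ‖ ≤ 1 := by rwa [l2_opNorm_conjTranspose]
  have h1 : G * K₁ * (V * diagonal e * Vᴴ) * K₂ =
      (W * U) * (diagonal d * (Uᴴ * K₁ * V) * (diagonal e * (Vᴴ * K₂))) := by
    conv_lhs => rw [← hGW]
    simp only [Matrix.mul_assoc]
  have h2 : diagonal d * (Uᴴ * K₁ * V) * (diagonal e * (Vᴴ * K₂)) * (W * U) =
      diagonal d * (Uᴴ * K₁ * V) * (diagonal e * (Vᴴ * K₂ * (W * U))) := by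
    simp only [Matrix.mul_assoc]
  rw [h1, Matrix.trace_mul_comm, h2]
  exact norm_trace_diagonal_mul_le (norm_mul_le_one (norm_mul_le_one nU' hK₁) nV)
    (norm_mul_le_one (norm_mul_le_one nV' hK₂) (norm_mul_le_one nW nU)) hc0 hc1 ha hb hm hd hg

/-- Hölder's inequality for Schatten norms. -/
theorem norm_trace_mul_hfn_le (G : Matrix n n ℂ) {K₁ K₂ : Matrix n n ℂ} (hK₁ : ‖K₁‖ ≤ 1)
    (hK₂ : ‖K₂‖ ≤ 1) (hH : H.IsHermitian) {g : ℝ → ℂ} {c : ℝ} (hc0 : 0 ≤ c) (hc1 : c ≤ 1)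
    {b : n → ℝ} (hb : ∀ i, 0 ≤ b i) (hg : ∀ i, ‖g (hH.eigenvalues i)‖ ≤ b i ^ (1 - c)) :
    ‖(G * K₁ * hfn hH g * K₂).trace‖ ≤ recipSchattenNorm c G * (∑ i, b i) ^ (1 - c) := by
  have h0 := eigenvalues_gram_nonneg G
  unfold recipSchattenNorm
  split_ifs with hc
  -- Operator norm case: with `a = 0` and `c = 0`, both `a i ^ c` and `(∑ i, a i) ^ c` equal `1`, so
  -- `m = ‖G‖` bounds the singular values.
  · subst hc
    refine (norm_trace_mul_hfn_le_of_le hK₁ hK₂ hH le_rfl zero_le_one (a := fun _ => 0)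
      (fun _ => le_rfl) hb (norm_nonneg G) (fun i => ?_) hg).trans (by simp)
    rw [Real.rpow_zero, mul_one, ← Real.sqrt_eq_rpow, Real.sqrt_le_left (norm_nonneg G), sq,
      ← l2_opNorm_conjTranspose_mul_self]
    exact eigenvalues_le_norm _ i
  · refine (norm_trace_mul_hfn_le_of_le hK₁ hK₂ hH hc0 hc1
      (fun i => Real.rpow_nonneg (h0 i) (1 / (2 * c))) hb zero_le_one (fun i => ?_) hg).trans ?_
    · rw [one_mul, ← Real.rpow_mul (h0 i)]
      refine le_of_eq ?_
      congr 1
      field_simp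
    · rw [one_mul]

end Holder

/-! ### Stein interpolation on the strip -/

section Interpolation

/-- Entire functions that are bounded on the closed strip `0 ≤ Re z ≤ 1`. -/
def StripBounded {E : Type*} [NormedAddCommGroup E] [NormedSpace ℂ E] (F : ℂ → E) : Prop :=
  Differentiable ℂ F ∧ ∃ C, ∀ z : ℂ, 0 ≤ z.re → z.re ≤ 1 → ‖F z‖ ≤ C

namespace StripBounded

theorem const {E : Type*} [NormedAddCommGroup E] [NormedSpace ℂ E] (X : E) :
    StripBounded fun _ : ℂ => X :=
  ⟨differentiable_const _, ‖X‖, fun _ _ _ => le_rfl⟩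

theorem mul {R : Type*} [NormedRing R] [NormedAlgebra ℂ R] {F G : ℂ → R}
    (hF : StripBounded F) (hG : StripBounded G) : StripBounded fun z => F z * G z := by
  obtain ⟨hF, C, hC⟩ := hF
  obtain ⟨hG, D, hD⟩ := hG
  exact ⟨hF.mul hG, C * D, fun z h0 h1 => (norm_mul_le _ _).trans
    (mul_le_mul (hC z h0 h1) (hD z h0 h1) (norm_nonneg _) ((norm_nonneg _).trans (hC z h0 h1)))⟩

theorem linear {E E' : Type*} [NormedAddCommGroup E] [NormedSpace ℂ E] [FiniteDimensional ℂ E]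
    [NormedAddCommGroup E'] [NormedSpace ℂ E'] (L : E →ₗ[ℂ] E') {F : ℂ → E}
    (hF : StripBounded F) : StripBounded fun z => L (F z) := by
  obtain ⟨hF, C, hC⟩ := hF
  refine ⟨(LinearMap.toContinuousLinearMap L).differentiable.comp hF,
    ‖LinearMap.toContinuousLinearMap L‖ * C, fun z h0 h1 => ?_⟩
  exact ((LinearMap.toContinuousLinearMap L).le_opNorm _).trans
    (mul_le_mul_of_nonneg_left (hC z h0 h1) (norm_nonneg _))

theorem pi {ι : Type*} [Fintype ι] {F : ℂ → ι → ℂ} (hF : ∀ i, StripBounded fun z => F z i) :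
    StripBounded F := by
  choose hd C hC using hF
  refine ⟨differentiable_pi.2 hd, ∑ i, |C i|, fun z h0 h1 => ?_⟩
  refine (pi_norm_le_iff_of_nonneg (Finset.sum_nonneg fun i _ => abs_nonneg _)).2 fun i => ?_
  exact ((hC i z h0 h1).trans (le_abs_self _)).trans
    (Finset.single_le_sum (f := fun i => |C i|) (fun i _ => abs_nonneg _) (Finset.mem_univ i))

/-- As `p` and `q` are real, the modulus depends only on `z.re`, so the unbounded imaginary
direction is harmless. -/
theorem suppCpow (p q x : ℝ) : StripBounded fun z : ℂ => suppCpow (p + q * z) x := by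
  unfold SwiveledRenyi.suppCpow
  split_ifs
  · exact const 0
  · refine ⟨by fun_prop, Real.exp (|Real.log x| * (|p| + |q|)), fun z h0 h1 => ?_⟩
    rw [Complex.norm_exp, Real.exp_le_exp, Complex.re_ofReal_mul, Complex.add_re,
      Complex.ofReal_re, Complex.re_ofReal_mul]
    refine (le_abs_self _).trans ?_
    rw [abs_mul]
    refine mul_le_mul_of_nonneg_left ((abs_add_le _ _).trans ?_) (abs_nonneg _)
    rw [abs_mul, abs_of_nonneg h0]
    exact add_le_add_right (mul_le_of_le_one_right (abs_nonneg _) h1) _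

variable {n : Type*} [Fintype n] [DecidableEq n]

theorem hfn {H : Matrix n n ℂ} (hH : H.IsHermitian) (p q : ℝ) :
    StripBounded fun z : ℂ => hfn hH (SwiveledRenyi.suppCpow (p + q * z)) := by
  unfold SwiveledRenyi.hfn
  refine ((const _).mul ?_).mul (const _)
  exact linear (Matrix.diagonalLinearMap n ℂ ℂ) (pi fun i => suppCpow p q _)

end StripBounded

variable {n : Type*} [Fintype n] [DecidableEq n]

/-- Stein interpolation for Schatten norms, the boundary values being controlled up to
contractions on both sides. -/
theorem recipSchattenNorm_interpolation {G : ℂ → Matrix n n ℂ} (hG : StripBounded G)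
    {c₀ c₁ θ M₀ M₁ : ℝ} (h00 : 0 ≤ c₀) (h01 : c₀ ≤ 1) (h10 : 0 ≤ c₁) (h11 : c₁ ≤ 1)
    (hθ0 : 0 ≤ θ) (hθ1 : θ ≤ 1) (hc : 0 < (1 - θ) * c₀ + θ * c₁)
    (hM₀ : ∀ z : ℂ, z.re = 0 → ∃ U X V : Matrix n n ℂ, ‖U‖ ≤ 1 ∧ ‖V‖ ≤ 1 ∧ G z = U * X * V ∧
      recipSchattenNorm c₀ X ≤ M₀)
    (hM₁ : ∀ z : ℂ, z.re = 1 → ∃ U X V : Matrix n n ℂ, ‖U‖ ≤ 1 ∧ ‖V‖ ≤ 1 ∧ G z = U * X * V ∧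
      recipSchattenNorm c₁ X ≤ M₁) :
    recipSchattenNorm ((1 - θ) * c₀ + θ * c₁) (G θ) ≤ M₀ ^ (1 - θ) * M₁ ^ θ := by
  have hM₀' : 0 ≤ M₀ := by
    obtain ⟨U, X, V, -, -, -, h⟩ := hM₀ 0 rfl
    exact (recipSchattenNorm_nonneg _ _).trans h
  have hM₁' : 0 ≤ M₁ := by
    obtain ⟨U, X, V, -, -, -, h⟩ := hM₁ 1 rfl
    exact (recipSchattenNorm_nonneg _ _).trans h
  obtain ⟨c, hcdef⟩ : ∃ c, c = (1 - θ) * c₀ + θ * c₁ := ⟨_, rfl⟩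
  rw [← hcdef] at hc ⊢
  have hlam := eigenvalues_gram_nonneg (G θ)
  set hH := isHermitian_conjTranspose_mul_self (G θ)
  rw [recipSchattenNorm, if_neg hc.ne']
  change (∑ i, hH.eigenvalues i ^ (1 / (2 * c))) ^ c ≤ _
  have hb : ∀ i, 0 ≤ hH.eigenvalues i ^ (1 / (2 * c)) := fun i => Real.rpow_nonneg (hlam i) _
  obtain ⟨T, hT⟩ : ∃ T, T = ∑ i, hH.eigenvalues i ^ (1 / (2 * c)) := ⟨_, rfl⟩
  have hT0 : 0 ≤ T := hT ▸ Finset.sum_nonneg fun i _ => hb i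
  rw [← hT]
  -- The dual exponent, acting on squared singular values. It has real part `(1 - c₀) / (2c)` and
  -- `(1 - c₁) / (2c)` on the two boundary lines, as Hölder's inequality requires, and `1 / 2 + E θ
  -- = 1 / (2c)`, so that the pairing at `θ` is exactly `T`.
  let E : ℂ → ℂ := fun z => ((1 - c₀) / (2 * c) : ℝ) + ((c₀ - c₁) / (2 * c) : ℝ) * z
  let f : ℂ → ℂ := fun z => (G z * hfn hH (suppCpow (E z)) * (polarPart (G θ))ᴴ).trace
  have hf : StripBounded f := StripBounded.linear (Matrix.traceLinearMap n ℂ ℂ)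
    ((hG.mul (StripBounded.hfn hH _ _)).mul (StripBounded.const _))
  have hfθ : f θ = T := by
    have hE : 1 / 2 + E θ = ((1 / (2 * c) : ℝ) : ℂ) := by
      simp only [E]
      have : (1 : ℝ) / 2 + ((1 - c₀) / (2 * c) + (c₀ - c₁) / (2 * c) * θ) = 1 / (2 * c) := by
        field_simp
        rw [hcdef]
        ring
      rw [← this]
      push_cast
      ring
    simp only [f]
    rw [Matrix.trace_mul_comm, ← Matrix.mul_assoc, polarPart_conjTranspose_mul, hfn_suppCpow_mul,
      hE, trace_hfn, hT, Complex.ofReal_sum]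
    refine Finset.sum_congr rfl fun i _ => ?_
    rw [suppCpow_ofReal (hlam i)]
    split_ifs with h
    · rw [show hH.eigenvalues i = 0 from h, Real.zero_rpow (by positivity)]
    · rfl
  have hbd : ∀ (z : ℂ) (d M : ℝ), 0 ≤ d → d ≤ 1 → (E z).re = (1 - d) / (2 * c) →
      (∃ U X V : Matrix n n ℂ, ‖U‖ ≤ 1 ∧ ‖V‖ ≤ 1 ∧ G z = U * X * V ∧
        recipSchattenNorm d X ≤ M) → ‖f z‖ ≤ M * T ^ (1 - d) := by
    rintro z d M hd0 hd1 hEz ⟨U, X, V, hU, hV, hUXV, hX⟩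
    have hW : ‖(polarPart (G θ))ᴴ‖ ≤ 1 := by
      rw [l2_opNorm_conjTranspose]
      exact norm_polarPart_le_one _
    -- Cyclicity moves the left contraction `U` next to the polar part, so only the Schatten norm of
    -- `X` enters.
    have h1 : f z = (X * V * hfn hH (suppCpow (E z)) * ((polarPart (G θ))ᴴ * U)).trace := by
      simp only [f]
      rw [hUXV, Matrix.mul_assoc U, Matrix.mul_assoc U, Matrix.mul_assoc U, Matrix.trace_mul_comm]
      simp only [Matrix.mul_assoc]
    rw [h1, hT]
    refine (norm_trace_mul_hfn_le X hV (norm_mul_le_one hW hU) hH hd0 hd1 hb fun i => ?_).trans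
      (mul_le_mul_of_nonneg_right hX (Real.rpow_nonneg (hT ▸ hT0) _))
    rw [norm_suppCpow (hlam i), hEz, ← Real.rpow_mul (hlam i)]
    split_ifs with h
    · exact Real.rpow_nonneg (hlam i) _
    · refine le_of_eq ?_
      congr 1
      ring
  have h3 := Complex.HadamardThreeLines.norm_le_interp_of_mem_verticalClosedStrip₀₁' f
    (z := (θ : ℂ)) (a := M₀ * T ^ (1 - c₀)) (b := M₁ * T ^ (1 - c₁))
    ⟨by simpa using hθ0, by simpa using hθ1⟩ hf.1.diffContOnCl
    (by
      obtain ⟨C, hC⟩ := hf.2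
      refine ⟨C, ?_⟩
      rintro _ ⟨z, hz, rfl⟩
      exact hC z hz.1 hz.2)
    (fun z hz => hbd z c₀ M₀ h00 h01 (by
        have hz0 : z.re = 0 := hz
        simp only [E, Complex.add_re, Complex.re_ofReal_mul, Complex.ofReal_re, hz0]
        ring) (hM₀ z hz))
    (fun z hz => hbd z c₁ M₁ h10 h11 (by
        have hz0 : z.re = 1 := hz
        simp only [E, Complex.add_re, Complex.re_ofReal_mul, Complex.ofReal_re, hz0]
        ring) (hM₁ z hz))
  rw [hfθ, Complex.norm_real, Real.norm_of_nonneg hT0, Complex.ofReal_re] at h3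
  -- The three lines theorem yields `T ≤ M₀ ^ (1 - θ) * M₁ ^ θ * T ^ (1 - c)`; for `T > 0` the last
  -- factor is divided out.
  rcases hT0.eq_or_lt with h0 | hTpos
  · rw [← h0, Real.zero_rpow hc.ne']
    positivity
  rw [Real.mul_rpow hM₀' (by positivity), Real.mul_rpow hM₁' (by positivity), mul_mul_mul_comm,
    ← Real.rpow_mul hT0, ← Real.rpow_mul hT0, ← Real.rpow_add hTpos] at h3
  have hexp : (1 - c₀) * (1 - θ) + (1 - c₁) * θ = 1 - c := by
    rw [hcdef]
    ring
  rw [hexp, ← div_le_iff₀ (by positivity)] at h3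
  calc T ^ c = T / T ^ (1 - c) := by
        rw [Real.rpow_sub hTpos, Real.rpow_one]
        field_simp
    _ ≤ _ := h3

end Interpolation

/-! ### Schatten norms, supports and imaginary powers -/

section SchattenNorm

variable {n : Type*} [Fintype n] [DecidableEq n]

/-- Since `|X| ^ p = (Xᴴ X) ^ (p / 2)`. The reciprocal exponent is the one that varies affinely
under interpolation, and `∞⁻¹ = 0` selects the operator norm. -/
theorem schattenNorm_eq_recipSchattenNorm {p : ℝ≥0∞} (hp : p ≠ 0) (X : Matrix n n ℂ) :
    schattenNorm p X = recipSchattenNorm p⁻¹.toReal X := by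
  unfold schattenNorm recipSchattenNorm
  by_cases hp' : p = ∞
  · simp [hp', l2_opNorm_toEuclideanCLM]
  · have h0 : p.toReal ≠ 0 := ENNReal.toReal_ne_zero.2 ⟨hp, hp'⟩
    rw [if_neg hp', ENNReal.toReal_inv, if_neg (inv_ne_zero h0), matAbs,
      suppPow_suppPow (posSemidef_conjTranspose_mul_self X),
      trace_suppPow_re (posSemidef_conjTranspose_mul_self X) (by positivity), one_div p.toReal]
    congr 1
    refine Finset.sum_congr rfl fun i _ => ?_
    congr 1
    field_simp

theorem exists_recipSchattenNorm_le {c : ℝ} (hc : 0 ≤ c) (R : ℝ) :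
    ∃ C, ∀ X : Matrix n n ℂ, ‖X‖ ≤ R → recipSchattenNorm c X ≤ C := by
  unfold recipSchattenNorm
  split_ifs with h
  · exact ⟨R, fun X hX => hX⟩
  · refine ⟨(∑ _i : n, (R * R) ^ (1 / (2 * c))) ^ c, fun X hX => ?_⟩
    refine Real.rpow_le_rpow (Finset.sum_nonneg fun i _ =>
      Real.rpow_nonneg (eigenvalues_gram_nonneg X i) _) (Finset.sum_le_sum fun i _ => ?_) hc
    refine Real.rpow_le_rpow (eigenvalues_gram_nonneg X i) ?_ (by positivity)
    refine (eigenvalues_le_norm _ i).trans ?_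
    rw [l2_opNorm_conjTranspose_mul_self]
    exact mul_le_mul hX hX (norm_nonneg _) ((norm_nonneg _).trans hX)

theorem recipSchattenNorm_half (X : Matrix n n ℂ) :
    recipSchattenNorm (1 / 2) X = √(Xᴴ * X).trace.re := by
  rw [recipSchattenNorm, if_neg (by norm_num), Real.sqrt_eq_rpow,
    (isHermitian_conjTranspose_mul_self X).trace_eq_sum_eigenvalues, Complex.re_sum]
  norm_num

theorem trace_conjTranspose_mul_self_re (X : Matrix n n ℂ) :
    (Xᴴ * X).trace.re = ∑ j, ∑ i, ‖X i j‖ ^ 2 := by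
  rw [Matrix.trace, Complex.re_sum]
  refine Finset.sum_congr rfl fun j _ => ?_
  rw [Matrix.diag_apply, Matrix.mul_apply, Complex.re_sum]
  refine Finset.sum_congr rfl fun i _ => ?_
  rw [conjTranspose_apply, Complex.star_def, ← Complex.normSq_eq_conj_mul_self,
    Complex.normSq_eq_norm_sq, Complex.ofReal_re]

/-- The squared Frobenius norm is the sum of the squared column norms, and `K` shrinks each column.
-/
theorem recipSchattenNorm_half_mul_le {K : Matrix n n ℂ} (hK : ‖K‖ ≤ 1) (X : Matrix n n ℂ) :
    recipSchattenNorm (1 / 2) (K * X) ≤ recipSchattenNorm (1 / 2) X := by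
  rw [recipSchattenNorm_half, recipSchattenNorm_half, trace_conjTranspose_mul_self_re,
    trace_conjTranspose_mul_self_re]
  refine Real.sqrt_le_sqrt (Finset.sum_le_sum fun j _ => ?_)
  have h := l2_opNorm_mulVec K (WithLp.toLp 2 (X.col j))
  have h2 := pow_le_pow_left₀ (norm_nonneg _)
    (h.trans (mul_le_of_le_one_left (norm_nonneg _) hK)) 2
  rw [EuclideanSpace.norm_sq_eq, EuclideanSpace.norm_sq_eq] at h2
  exact h2

/-- A projection that carries no weight under `ρ` is annihilated by the square root of `ρ`. -/
theorem suppPow_half_mul_eq_zero {ρ Q : Matrix n n ℂ} (hρ : ρ.PosSemidef) (hQ : Qᴴ = Q)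
    (hQQ : Q * Q = Q) (htr : (ρ * Q).trace = 0) : suppPow ρ (1 / 2) * Q = 0 := by
  rw [← trace_conjTranspose_mul_self_eq_zero_iff, conjTranspose_mul, hQ,
    suppPow_conjTranspose hρ, Matrix.mul_assoc, ← Matrix.mul_assoc (suppPow ρ (1 / 2)),
    suppPow_mul hρ, add_halves, suppPow_one hρ, Matrix.trace_mul_comm, Matrix.mul_assoc, hQQ, htr]

/-- The phase `x ^ (i q Im z)` splits off. Being a function of `H` it commutes with `H`, and
`Real.log 0 = 0` makes it `1` on the kernel, so it is unitary on the whole space. Both orders of the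
factorisation are needed, since in the chain some phases leave to the left and others to the right.
-/
theorem hfn_suppCpow_affine {H : Matrix n n ℂ} (hH : H.PosSemidef) (p q : ℝ) (z : ℂ) :
    ∃ U ∈ swivels H, hfn hH.1 (suppCpow (p + q * z)) = U * suppPow H (p + q * z.re) ∧
      hfn hH.1 (suppCpow (p + q * z)) = suppPow H (p + q * z.re) * U := by
  have hx : ∀ x, suppCpow (p + q * z) x =
      Complex.exp ((Real.log x * (q * z.im) : ℝ) * Complex.I) *
        suppCpow ((p + q * z.re : ℝ) : ℂ) x := fun x => by
    unfold suppCpow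
    split_ifs
    · simp
    · rw [← Complex.exp_add]
      congr 1
      conv_lhs => rw [← Complex.re_add_im z]
      push_cast
      ring
  refine ⟨hfn hH.1 fun x => Complex.exp ((Real.log x * (q * z.im) : ℝ) * Complex.I),
    ⟨hfn_mem_unitaryGroup hH.1 fun x => Complex.norm_exp_ofReal_mul_I _, hfn_commute _ _⟩, ?_, ?_⟩
  · rw [suppPow_eq_hfn hH, hfn_mul]
    exact hfn_congr _ fun i => hx _
  · rw [suppPow_eq_hfn hH, hfn_mul]
    exact hfn_congr _ fun i => (hx _).trans (mul_comm _ _)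

theorem mul_mem_swivels {H U V : Matrix n n ℂ} (hU : U ∈ swivels H) (hV : V ∈ swivels H) :
    U * V ∈ swivels H :=
  ⟨mul_mem hU.1 hV.1, hU.2.mul_left hV.2⟩

theorem one_mem_swivels (H : Matrix n n ℂ) : (1 : Matrix n n ℂ) ∈ swivels H :=
  ⟨one_mem _, Commute.one_left H⟩

theorem suppPow_zero_mul_self {H : Matrix n n ℂ} (hH : H.PosSemidef) :
    suppPow H 0 * suppPow H 0 = suppPow H 0 := by
  rw [suppPow_mul hH, add_zero]

theorem mul_suppPow_zero {H : Matrix n n ℂ} (hH : H.PosSemidef) : H * suppPow H 0 = H := by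
  conv_lhs => rw [← suppPow_one hH, suppPow_suppPow hH, suppPow_mul hH]
  rw [mul_zero, add_zero, suppPow_one hH]

end SchattenNorm

/-! ### Lifting operators, and marginals -/

section Tripartite

variable {A B C : Type*} [Fintype A] [Fintype B] [Fintype C]
  [DecidableEq A] [DecidableEq B] [DecidableEq C]

theorem liftBC_mul (X Y : Matrix (B × C) (B × C) ℂ) :
    liftBC (A := A) (X * Y) = liftBC X * liftBC Y := by
  rw [liftBC, liftBC, liftBC, ← mul_kronecker_mul, Matrix.one_mul]

theorem liftBC_one : liftBC (A := A) (1 : Matrix (B × C) (B × C) ℂ) = 1 :=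
  one_kronecker_one

theorem liftBC_conjTranspose (X : Matrix (B × C) (B × C) ℂ) :
    (liftBC (A := A) X)ᴴ = liftBC Xᴴ := by
  rw [liftBC, conjTranspose_kronecker, conjTranspose_one, liftBC]

theorem liftC_mul (X Y : Matrix C C ℂ) :
    liftC (A := A) (B := B) (X * Y) = liftC X * liftC Y := by
  rw [liftC, liftC, liftC, ← mul_kronecker_mul, ← mul_kronecker_mul, Matrix.one_mul, Matrix.one_mul]

theorem liftC_one : liftC (A := A) (B := B) (1 : Matrix C C ℂ) = 1 := by
  rw [liftC, one_kronecker_one, one_kronecker_one]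

theorem liftC_conjTranspose (X : Matrix C C ℂ) :
    (liftC (A := A) (B := B) X)ᴴ = liftC Xᴴ := by
  rw [liftC, conjTranspose_kronecker, conjTranspose_kronecker, conjTranspose_one, conjTranspose_one,
    liftC]

theorem liftAC_mul (X Y : Matrix (A × C) (A × C) ℂ) :
    liftAC (B := B) (X * Y) = liftAC X * liftAC Y := by
  ext ⟨a, b, c⟩ ⟨a', b', c'⟩
  simp only [liftAC, Matrix.of_apply, Matrix.mul_apply, Fintype.sum_prod_type]
  by_cases h : b = b'
  · subst h
    simp only [if_true]
    refine Finset.sum_congr rfl fun x _ => ?_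
    rw [Finset.sum_eq_single b]
    · simp
    · intro y _ hy
      simp [hy]
    · simp
  · rw [if_neg h]
    refine (Finset.sum_eq_zero fun x _ => Finset.sum_eq_zero fun y _ =>
      Finset.sum_eq_zero fun z _ => ?_).symm
    by_cases h1 : b = y
    · subst h1
      simp [h]
    · simp [h1]

theorem liftAC_one : liftAC (B := B) (1 : Matrix (A × C) (A × C) ℂ) = 1 := by
  ext ⟨a, b, c⟩ ⟨a', b', c'⟩
  simp only [liftAC, Matrix.of_apply, Matrix.one_apply, Prod.mk.injEq]
  by_cases h1 : a = a' <;> by_cases h2 : b = b' <;> by_cases h3 : c = c' <;> simp [h1, h2, h3]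

theorem liftAC_conjTranspose (X : Matrix (A × C) (A × C) ℂ) :
    (liftAC (B := B) X)ᴴ = liftAC Xᴴ := by
  ext ⟨a, b, c⟩ ⟨a', b', c'⟩
  simp only [liftAC, Matrix.of_apply, conjTranspose_apply]
  by_cases h : b = b'
  · simp [h]
  · simp [h, Ne.symm h]

/-- `liftBC` as a linear map. -/
def liftBCLinear : Matrix (B × C) (B × C) ℂ →ₗ[ℂ] Matrix (A × B × C) (A × B × C) ℂ where
  toFun := liftBC
  map_add' := kronecker_add _
  map_smul' r := kronecker_smul r _

/-- `liftC` as a linear map. -/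
def liftCLinear : Matrix C C ℂ →ₗ[ℂ] Matrix (A × B × C) (A × B × C) ℂ where
  toFun := liftC
  map_add' X Y := by rw [liftC, kronecker_add, kronecker_add]; rfl
  map_smul' r X := by rw [liftC, kronecker_smul, kronecker_smul]; rfl

/-- `liftAC` as a linear map. -/
def liftACLinear : Matrix (A × C) (A × C) ℂ →ₗ[ℂ] Matrix (A × B × C) (A × B × C) ℂ where
  toFun := liftAC
  map_add' X Y := by
    ext i j
    simp only [liftAC, Matrix.of_apply, Matrix.add_apply]
    split_ifs <;> simp
  map_smul' r X := by
    ext i j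
    simp only [liftAC, Matrix.of_apply, Matrix.smul_apply, RingHom.id_apply]
    split_ifs <;> simp

theorem norm_liftBC_le_one {U : Matrix (B × C) (B × C) ℂ} (hU : U ∈ unitaryGroup (B × C) ℂ) :
    ‖liftBC (A := A) U‖ ≤ 1 := by
  refine norm_le_one_of_conjTranspose_mul ?_
  rw [liftBC_conjTranspose, ← liftBC_mul, ← star_eq_conjTranspose, mem_unitaryGroup_iff'.1 hU,
    liftBC_one]

theorem norm_liftC_le_one {U : Matrix C C ℂ} (hU : U ∈ unitaryGroup C ℂ) :
    ‖liftC (A := A) (B := B) U‖ ≤ 1 := by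
  refine norm_le_one_of_conjTranspose_mul ?_
  rw [liftC_conjTranspose, ← liftC_mul, ← star_eq_conjTranspose, mem_unitaryGroup_iff'.1 hU,
    liftC_one]

theorem norm_liftAC_le_one {U : Matrix (A × C) (A × C) ℂ} (hU : U ∈ unitaryGroup (A × C) ℂ) :
    ‖liftAC (B := B) U‖ ≤ 1 := by
  refine norm_le_one_of_conjTranspose_mul ?_
  rw [liftAC_conjTranspose, ← liftAC_mul, ← star_eq_conjTranspose, mem_unitaryGroup_iff'.1 hU,
    liftAC_one]

/-- Partial trace is adjoint to tensoring with the identity. -/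
theorem trace_mul_one_kronecker {ι κ : Type*} [Fintype ι] [DecidableEq ι] [Fintype κ]
    (M : Matrix (ι × κ) (ι × κ) ℂ) (X : Matrix κ κ ℂ) :
    (M * ((1 : Matrix ι ι ℂ) ⊗ₖ X)).trace =
      (Matrix.of (fun i j => ∑ a, M (a, i) (a, j)) * X).trace := by
  have h : ∀ a i, (M * ((1 : Matrix ι ι ℂ) ⊗ₖ X)) (a, i) (a, i) =
      ∑ j, M (a, i) (a, j) * X j i := fun a i => by
    rw [Matrix.mul_apply, Fintype.sum_prod_type, Finset.sum_eq_single a]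
    · simp
    · intro y _ hy
      simp [hy]
    · simp
  simp only [Matrix.trace, Matrix.diag_apply]
  rw [Fintype.sum_prod_type, Finset.sum_comm]
  refine Finset.sum_congr rfl fun i _ => ?_
  simp only [h]
  simp only [Matrix.mul_apply, Matrix.of_apply, Finset.sum_mul]
  exact Finset.sum_comm

theorem trace_mul_liftBC (ρ : Matrix (A × B × C) (A × B × C) ℂ) (X : Matrix (B × C) (B × C) ℂ) :
    (ρ * liftBC X).trace = (margBC ρ * X).trace :=
  trace_mul_one_kronecker ρ X

theorem trace_mul_liftAC (ρ : Matrix (A × B × C) (A × B × C) ℂ) (X : Matrix (A × C) (A × C) ℂ) :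
    (ρ * liftAC X).trace = (margAC ρ * X).trace := by
  have h : ∀ a b c, (ρ * liftAC X :
      Matrix (A × B × C) (A × B × C) ℂ) (a, b, c) (a, b, c) =
      ∑ j : A × C, ρ (a, b, c) (j.1, b, j.2) * X j (a, c) := fun a b c => by
    rw [Matrix.mul_apply, Fintype.sum_prod_type, Fintype.sum_prod_type]
    refine Finset.sum_congr rfl fun x _ => ?_
    rw [Fintype.sum_prod_type, Finset.sum_eq_single b]
    · simp [liftAC]
    · intro y _ hy
      simp [liftAC, hy]
    · simp
  simp only [Matrix.trace, Matrix.diag_apply]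
  rw [Fintype.sum_prod_type, Fintype.sum_prod_type]
  refine Finset.sum_congr rfl fun a _ => ?_
  rw [Fintype.sum_prod_type, Finset.sum_comm]
  refine Finset.sum_congr rfl fun c _ => ?_
  simp only [h, Matrix.mul_apply, margAC, Matrix.of_apply, Finset.sum_mul]
  exact Finset.sum_comm

theorem trace_mul_liftC (ρ : Matrix (A × B × C) (A × B × C) ℂ) (X : Matrix C C ℂ) :
    (ρ * liftC X).trace = (margC ρ * X).trace := by
  have h : margC ρ = Matrix.of fun i j => ∑ b, margBC ρ (b, i) (b, j) := by
    ext i j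
    exact Finset.sum_comm
  rw [h, ← trace_mul_one_kronecker]
  exact trace_mul_one_kronecker ρ _

theorem margBC_posSemidef {ρ : Matrix (A × B × C) (A × B × C) ℂ} (hρ : ρ.PosSemidef) :
    (margBC ρ).PosSemidef := by
  have : margBC ρ = ∑ a : A, ρ.submatrix (fun i => (a, i)) (fun i => (a, i)) := by
    ext i j
    simp [margBC, Matrix.sum_apply]
  rw [this]
  exact posSemidef_sum _ fun a _ => hρ.submatrix _

theorem margAC_posSemidef {ρ : Matrix (A × B × C) (A × B × C) ℂ} (hρ : ρ.PosSemidef) :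
    (margAC ρ).PosSemidef := by
  have : margAC ρ = ∑ b : B, ρ.submatrix (fun i => (i.1, b, i.2)) (fun i => (i.1, b, i.2)) := by
    ext i j
    simp [margAC, Matrix.sum_apply]
  rw [this]
  exact posSemidef_sum _ fun b _ => hρ.submatrix _

theorem margC_posSemidef {ρ : Matrix (A × B × C) (A × B × C) ℂ} (hρ : ρ.PosSemidef) :
    (margC ρ).PosSemidef := by
  have : margC ρ = ∑ a : A, ∑ b : B, ρ.submatrix (fun i => (a, b, i)) (fun i => (a, b, i)) := by
    ext i j
    simp [margC, Matrix.sum_apply]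
  rw [this]
  exact posSemidef_sum _ fun a _ => posSemidef_sum _ fun b _ => hρ.submatrix _

/-- A projection of full weight under `ρ` fixes the square root of `ρ`. -/
theorem mul_suppPow_half {n : Type*} [Fintype n] [DecidableEq n] {ρ P : Matrix n n ℂ}
    (hρ : ρ.PosSemidef) (hP : Pᴴ = P) (hPP : P * P = P) (htr : (ρ * P).trace = ρ.trace) :
    P * suppPow ρ (1 / 2) = suppPow ρ (1 / 2) := by
  have h := suppPow_half_mul_eq_zero (Q := 1 - P) hρ (by rw [conjTranspose_sub, hP,
    conjTranspose_one]) (by rw [Matrix.sub_mul, Matrix.one_mul, Matrix.mul_sub, hPP, Matrix.mul_one]; simp)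
    (by rw [Matrix.mul_sub, Matrix.trace_sub, htr, Matrix.mul_one, sub_self])
  have h2 := congrArg conjTranspose h
  rw [conjTranspose_mul, conjTranspose_sub, conjTranspose_one, hP, suppPow_conjTranspose hρ,
    conjTranspose_zero, Matrix.sub_mul, Matrix.one_mul, sub_eq_zero] at h2
  exact h2.symm

/-! ### The chain at `s = 0`, and uniform bounds -/

variable {ρ : Matrix (A × B × C) (A × B × C) ℂ}

/-- The support projection of a marginal has full weight under that marginal, hence its lift has
full weight under `ρ`. This replaces invertibility assumptions. -/
theorem liftBC_supp_mul (hρ : ρ.PosSemidef) :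
    liftBC (suppPow (margBC ρ) 0) * suppPow ρ (1 / 2) = suppPow ρ (1 / 2) := by
  have hm := margBC_posSemidef hρ
  refine mul_suppPow_half hρ (by rw [liftBC_conjTranspose, suppPow_conjTranspose hm])
    (by rw [← liftBC_mul, suppPow_zero_mul_self hm]) ?_
  rw [trace_mul_liftBC, mul_suppPow_zero hm, ← Matrix.mul_one (margBC ρ), ← trace_mul_liftBC,
    liftBC_one, Matrix.mul_one]

theorem liftAC_supp_mul (hρ : ρ.PosSemidef) :
    liftAC (suppPow (margAC ρ) 0) * suppPow ρ (1 / 2) = suppPow ρ (1 / 2) := by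
  have hm := margAC_posSemidef hρ
  refine mul_suppPow_half hρ (by rw [liftAC_conjTranspose, suppPow_conjTranspose hm])
    (by rw [← liftAC_mul, suppPow_zero_mul_self hm]) ?_
  rw [trace_mul_liftAC, mul_suppPow_zero hm, ← Matrix.mul_one (margAC ρ), ← trace_mul_liftAC,
    liftAC_one, Matrix.mul_one]

theorem liftC_supp_mul (hρ : ρ.PosSemidef) :
    liftC (suppPow (margC ρ) 0) * suppPow ρ (1 / 2) = suppPow ρ (1 / 2) := by
  have hm := margC_posSemidef hρ
  refine mul_suppPow_half hρ (by rw [liftC_conjTranspose, suppPow_conjTranspose hm])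
    (by rw [← liftC_mul, suppPow_zero_mul_self hm]) ?_
  rw [trace_mul_liftC, mul_suppPow_zero hm, ← Matrix.mul_one (margC ρ), ← trace_mul_liftC,
    liftC_one, Matrix.mul_one]

theorem recipSchattenNorm_half_suppPow (hρ : IsDensityOperator ρ) :
    recipSchattenNorm (1 / 2) (suppPow ρ (1 / 2)) = 1 := by
  rw [recipSchattenNorm_half, suppPow_conjTranspose hρ.1, suppPow_mul hρ.1, add_halves,
    suppPow_one hρ.1, hρ.2, Complex.one_re, Real.sqrt_one]

theorem recipSchattenNorm_chain_zero_one (hρ : IsDensityOperator ρ) :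
    recipSchattenNorm (1 / 2) (chain ρ 0 (1 / 2) 1 1) = 1 := by
  have : chain ρ 0 (1 / 2) 1 1 = suppPow ρ (1 / 2) := by
    rw [chain, neg_zero, zero_div, liftC_one, liftAC_one, Matrix.mul_one, Matrix.mul_one,
      Matrix.mul_assoc, liftAC_supp_mul hρ.1, Matrix.mul_assoc, liftC_supp_mul hρ.1,
      liftBC_supp_mul hρ.1]
  rw [this, recipSchattenNorm_half_suppPow hρ]

/-- Everything to the left of `√ρ` is a projection or a unitary, hence a contraction. -/
theorem recipSchattenNorm_chain_zero_le (hρ : IsDensityOperator ρ)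
    {V : Matrix (A × C) (A × C) ℂ} {W : Matrix C C ℂ} (hV : V ∈ swivels (margAC ρ))
    (hW : W ∈ swivels (margC ρ)) : recipSchattenNorm (1 / 2) (chain ρ 0 (1 / 2) V W) ≤ 1 := by
  have hBC := margBC_posSemidef hρ.1
  have hAC := margAC_posSemidef hρ.1
  have hC := margC_posSemidef hρ.1
  rw [chain, neg_zero, zero_div]
  refine (recipSchattenNorm_half_mul_le ?_ _).trans (recipSchattenNorm_half_suppPow hρ).le
  refine norm_mul_le_one (norm_mul_le_one (norm_mul_le_one (norm_mul_le_one ?_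
    (norm_liftC_le_one hW.1)) ?_) ?_) (norm_liftAC_le_one hV.1)
  · exact norm_le_one_of_projection (by rw [liftBC_conjTranspose, suppPow_conjTranspose hBC])
      (by rw [← liftBC_mul, suppPow_zero_mul_self hBC])
  · exact norm_le_one_of_projection (by rw [liftC_conjTranspose, suppPow_conjTranspose hC])
      (by rw [← liftC_mul, suppPow_zero_mul_self hC])
  · exact norm_le_one_of_projection (by rw [liftAC_conjTranspose, suppPow_conjTranspose hAC])
      (by rw [← liftAC_mul, suppPow_zero_mul_self hAC])

/-- The swiveled chains with fixed exponents are uniformly bounded in Schatten norm. -/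
theorem exists_recipSchattenNorm_chain_le (ρ : Matrix (A × B × C) (A × B × C) ℂ) {c : ℝ}
    (hc : 0 ≤ c) (s t : ℝ) : ∃ R, ∀ V ∈ swivels (margAC ρ), ∀ W ∈ swivels (margC ρ),
      recipSchattenNorm c (chain ρ s t V W) ≤ R := by
  obtain ⟨R, hR⟩ := exists_recipSchattenNorm_le (n := A × B × C) hc
    (‖liftBC (A := A) (suppPow (margBC ρ) (-s / 2))‖ * 1 *
      ‖liftC (A := A) (B := B) (suppPow (margC ρ) (s / 2))‖ *
      ‖liftAC (B := B) (suppPow (margAC ρ) (-s / 2))‖ * 1 * ‖suppPow ρ t‖)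
  refine ⟨R, fun V hV W hW => hR _ ?_⟩
  have hV' := norm_liftAC_le_one (B := B) hV.1
  have hW' := norm_liftC_le_one (A := A) (B := B) hW.1
  unfold chain
  refine (norm_mul_le _ _).trans (mul_le_mul_of_nonneg_right ?_ (norm_nonneg _))
  refine (norm_mul_le _ _).trans (mul_le_mul ?_ hV' (norm_nonneg _) (by positivity))
  refine (norm_mul_le _ _).trans (mul_le_mul_of_nonneg_right ?_ (norm_nonneg _))
  refine (norm_mul_le _ _).trans (mul_le_mul_of_nonneg_right ?_ (norm_nonneg _))
  exact (norm_mul_le _ _).trans (mul_le_mul_of_nonneg_left hW' (norm_nonneg _))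

/-! ### Interpolation of swiveled chains -/

/-- The chain with exponents interpolating between `(s₀, t₀)` and `(s₁, t₁)` along the strip. -/
def complexChain (hρ : ρ.PosSemidef) (s₀ s₁ t₀ t₁ : ℝ) (V : Matrix (A × C) (A × C) ℂ)
    (W : Matrix C C ℂ) (z : ℂ) : Matrix (A × B × C) (A × B × C) ℂ :=
  liftBC (hfn (margBC_posSemidef hρ).1
      (suppCpow ((-s₀ / 2 : ℝ) + ((s₀ - s₁) / 2 : ℝ) * z))) * liftC W *
    liftC (hfn (margC_posSemidef hρ).1 (suppCpow ((s₀ / 2 : ℝ) + ((s₁ - s₀) / 2 : ℝ) * z))) *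
    liftAC (hfn (margAC_posSemidef hρ).1
      (suppCpow ((-s₀ / 2 : ℝ) + ((s₀ - s₁) / 2 : ℝ) * z))) * liftAC V *
    hfn hρ.1 (suppCpow (t₀ + (t₁ - t₀ : ℝ) * z))

theorem complexChain_stripBounded (hρ : ρ.PosSemidef) (s₀ s₁ t₀ t₁ : ℝ)
    (V : Matrix (A × C) (A × C) ℂ) (W : Matrix C C ℂ) :
    StripBounded (complexChain hρ s₀ s₁ t₀ t₁ V W) := by
  have h₁ := StripBounded.linear (liftBCLinear (A := A))
    (StripBounded.hfn (margBC_posSemidef hρ).1 (-s₀ / 2) ((s₀ - s₁) / 2))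
  have h₂ := StripBounded.linear (liftCLinear (A := A) (B := B))
    (StripBounded.hfn (margC_posSemidef hρ).1 (s₀ / 2) ((s₁ - s₀) / 2))
  have h₃ := StripBounded.linear (liftACLinear (B := B))
    (StripBounded.hfn (margAC_posSemidef hρ).1 (-s₀ / 2) ((s₀ - s₁) / 2))
  have h₄ := StripBounded.hfn hρ.1 t₀ (t₁ - t₀)
  exact ((((h₁.mul (StripBounded.const (liftC W))).mul h₂).mul h₃).mul
    (StripBounded.const (liftAC V))).mul h₄

theorem complexChain_ofReal (hρ : ρ.PosSemidef) (s₀ s₁ t₀ t₁ θ : ℝ)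
    (V : Matrix (A × C) (A × C) ℂ) (W : Matrix C C ℂ) :
    complexChain hρ s₀ s₁ t₀ t₁ V W θ =
      chain ρ ((1 - θ) * s₀ + θ * s₁) ((1 - θ) * t₀ + θ * t₁) V W := by
  have e : ∀ p q r : ℝ, p + q * θ = r → (p : ℂ) + (q : ℂ) * (θ : ℂ) = (r : ℂ) :=
    fun p q r h => by rw [← h]; push_cast; rfl
  rw [complexChain, e (-s₀ / 2) ((s₀ - s₁) / 2) (-((1 - θ) * s₀ + θ * s₁) / 2) (by ring),
    e (s₀ / 2) ((s₁ - s₀) / 2) (((1 - θ) * s₀ + θ * s₁) / 2) (by ring),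
    e t₀ (t₁ - t₀) ((1 - θ) * t₀ + θ * t₁) (by ring), chain,
    suppPow_eq_hfn (margBC_posSemidef hρ), suppPow_eq_hfn (margC_posSemidef hρ),
    suppPow_eq_hfn (margAC_posSemidef hρ), suppPow_eq_hfn hρ]

/-- The imaginary powers are absorbed by the swivels and by unitaries at both ends. -/
theorem exists_complexChain_eq (hρ : ρ.PosSemidef) (s₀ s₁ t₀ t₁ : ℝ)
    {V : Matrix (A × C) (A × C) ℂ} {W : Matrix C C ℂ} (hV : V ∈ swivels (margAC ρ))
    (hW : W ∈ swivels (margC ρ)) (z : ℂ) {s t : ℝ} (hs : s₀ + (s₁ - s₀) * z.re = s)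
    (ht : t₀ + (t₁ - t₀) * z.re = t) :
    ∃ V' ∈ swivels (margAC ρ), ∃ W' ∈ swivels (margC ρ),
      ∃ U U' : Matrix (A × B × C) (A × B × C) ℂ, ‖U‖ ≤ 1 ∧ ‖U'‖ ≤ 1 ∧
        complexChain hρ s₀ s₁ t₀ t₁ V W z = U * chain ρ s t V' W' * U' := by
  obtain ⟨U₁, hU₁, e₁, -⟩ :=
    hfn_suppCpow_affine (margBC_posSemidef hρ) (-s₀ / 2) ((s₀ - s₁) / 2) z
  obtain ⟨U₂, hU₂, e₂, -⟩ := hfn_suppCpow_affine (margC_posSemidef hρ) (s₀ / 2) ((s₁ - s₀) / 2) z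
  obtain ⟨U₃, hU₃, -, e₃⟩ :=
    hfn_suppCpow_affine (margAC_posSemidef hρ) (-s₀ / 2) ((s₀ - s₁) / 2) z
  obtain ⟨U₄, hU₄, -, e₄⟩ := hfn_suppCpow_affine hρ t₀ (t₁ - t₀) z
  have h₁ : -s₀ / 2 + (s₀ - s₁) / 2 * z.re = -s / 2 := by rw [← hs]; ring
  have h₂ : s₀ / 2 + (s₁ - s₀) / 2 * z.re = s / 2 := by rw [← hs]; ring
  rw [h₁] at e₁ e₃
  rw [h₂] at e₂
  rw [ht] at e₄
  -- The phase of `ρ_AC` is taken on the right, next to `V`, and that of `ρ_C` on the left, next to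
  -- `W`; those of `ρ_BC` and `ρ` become the outer factors.
  refine ⟨U₃ * V, mul_mem_swivels hU₃ hV, W * U₂, mul_mem_swivels hW hU₂, liftBC U₁, U₄,
    norm_liftBC_le_one hU₁.1, norm_le_one_of_mem_unitaryGroup hU₄.1, ?_⟩
  rw [complexChain, e₁, e₂, e₃, e₄, chain, liftBC_mul, liftC_mul, liftC_mul, liftAC_mul, liftAC_mul]
  simp only [Matrix.mul_assoc]

/-- Interpolation between swiveled chains. -/
theorem recipSchattenNorm_chain_interpolation (hρ : ρ.PosSemidef)
    {c₀ c₁ θ s₀ s₁ t₀ t₁ M₀ M₁ : ℝ} (h00 : 0 ≤ c₀) (h01 : c₀ ≤ 1) (h10 : 0 ≤ c₁) (h11 : c₁ ≤ 1)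
    (hθ0 : 0 ≤ θ) (hθ1 : θ ≤ 1) (hc : 0 < (1 - θ) * c₀ + θ * c₁)
    (hM₀ : ∀ V ∈ swivels (margAC ρ), ∀ W ∈ swivels (margC ρ),
      recipSchattenNorm c₀ (chain ρ s₀ t₀ V W) ≤ M₀)
    (hM₁ : ∀ V ∈ swivels (margAC ρ), ∀ W ∈ swivels (margC ρ),
      recipSchattenNorm c₁ (chain ρ s₁ t₁ V W) ≤ M₁)
    {V : Matrix (A × C) (A × C) ℂ} {W : Matrix C C ℂ} (hV : V ∈ swivels (margAC ρ))
    (hW : W ∈ swivels (margC ρ)) :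
    recipSchattenNorm ((1 - θ) * c₀ + θ * c₁)
      (chain ρ ((1 - θ) * s₀ + θ * s₁) ((1 - θ) * t₀ + θ * t₁) V W) ≤ M₀ ^ (1 - θ) * M₁ ^ θ := by
  rw [← complexChain_ofReal hρ]
  refine recipSchattenNorm_interpolation (complexChain_stripBounded hρ s₀ s₁ t₀ t₁ V W)
    h00 h01 h10 h11 hθ0 hθ1 hc (fun z hz => ?_) fun z hz => ?_
  · obtain ⟨V', hV', W', hW', U, U', hU, hU', h⟩ := exists_complexChain_eq hρ s₀ s₁ t₀ t₁ hV hW z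
      (s := s₀) (t := t₀) (by rw [hz]; ring) (by rw [hz]; ring)
    exact ⟨U, _, U', hU, hU', h, hM₀ V' hV' W' hW'⟩
  · obtain ⟨V', hV', W', hW', U, U', hU, hU', h⟩ := exists_complexChain_eq hρ s₀ s₁ t₀ t₁ hV hW z
      (s := s₁) (t := t₁) (by rw [hz]; ring) (by rw [hz]; ring)
    exact ⟨U, _, U', hU, hU', h, hM₁ V' hV' W' hW'⟩

end Tripartite

/-! ### Log-convexity and monotone secant slopes -/

section Monotonicity

variable {A B C : Type*} [Fintype A] [Fintype B] [Fintype C]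
  [DecidableEq A] [DecidableEq B] [DecidableEq C]

/-- The supremum over the swivels of the Schatten norm of exponent `1 / c` of the chain. -/
def swivelSup (ρ : Matrix (A × B × C) (A × B × C) ℂ) (c s t : ℝ) : ℝ≥0∞ :=
  ⨆ V ∈ swivels (margAC ρ), ⨆ W ∈ swivels (margC ρ),
    ENNReal.ofReal (recipSchattenNorm c (chain ρ s t V W))

variable {ρ : Matrix (A × B × C) (A × B × C) ℂ}

/-- The extended logarithm is an order isomorphism, so it commutes with suprema, the value `-∞`
included. -/
theorem iSup_logSchattenNorm {p : ℝ≥0∞} (hp : p ≠ 0) (s t : ℝ) :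
    ⨆ V ∈ swivels (margAC ρ), ⨆ W ∈ swivels (margC ρ), logSchattenNorm p (chain ρ s t V W) =
      ENNReal.log (swivelSup ρ p⁻¹.toReal s t) := by
  simp only [← ENNReal.logOrderIso_apply, swivelSup, OrderIso.map_iSup, logSchattenNorm,
    schattenNorm_eq_recipSchattenNorm hp]

theorem swivelSup_ne_top (ρ : Matrix (A × B × C) (A × B × C) ℂ) {c : ℝ} (hc : 0 ≤ c) (s t : ℝ) :
    swivelSup ρ c s t ≠ ∞ := by
  obtain ⟨R, hR⟩ := exists_recipSchattenNorm_chain_le ρ hc s t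
  refine ne_top_of_le_ne_top ENNReal.ofReal_ne_top (b := ENNReal.ofReal R) ?_
  exact iSup₂_le fun V hV => iSup₂_le fun W hW => ENNReal.ofReal_le_ofReal (hR V hV W hW)

theorem recipSchattenNorm_le_swivelSup {c : ℝ} (hc : 0 ≤ c) (s t : ℝ)
    {V : Matrix (A × C) (A × C) ℂ} {W : Matrix C C ℂ} (hV : V ∈ swivels (margAC ρ))
    (hW : W ∈ swivels (margC ρ)) :
    recipSchattenNorm c (chain ρ s t V W) ≤ (swivelSup ρ c s t).toReal := by
  refine (ENNReal.ofReal_le_iff_le_toReal (swivelSup_ne_top ρ hc s t)).1 ?_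
  exact (le_iSup₂ (f := fun W (_ : W ∈ swivels (margC ρ)) =>
    ENNReal.ofReal (recipSchattenNorm c (chain ρ s t V W))) W hW).trans
    (le_iSup₂ (f := fun V (_ : V ∈ swivels (margAC ρ)) => ⨆ W ∈ swivels (margC ρ),
      ENNReal.ofReal (recipSchattenNorm c (chain ρ s t V W))) V hV)

theorem swivelSup_toReal_le {c s t R : ℝ} (hR0 : 0 ≤ R)
    (hR : ∀ V ∈ swivels (margAC ρ), ∀ W ∈ swivels (margC ρ),
      recipSchattenNorm c (chain ρ s t V W) ≤ R) : (swivelSup ρ c s t).toReal ≤ R :=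
  ENNReal.toReal_le_of_le_ofReal hR0 <|
    iSup₂_le fun V hV => iSup₂_le fun W hW => ENNReal.ofReal_le_ofReal (hR V hV W hW)

theorem swivelSup_zero (hρ : IsDensityOperator ρ) : (swivelSup ρ (1 / 2) 0 (1 / 2)).toReal = 1 := by
  refine le_antisymm (swivelSup_toReal_le zero_le_one fun V hV W hW =>
    recipSchattenNorm_chain_zero_le hρ hV hW) ?_
  exact (recipSchattenNorm_chain_zero_one hρ).ge.trans
    (recipSchattenNorm_le_swivelSup (by norm_num) _ _ (one_mem_swivels _) (one_mem_swivels _))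

/-- `swivelSup` along the lines on which the Rényi quantities live: `κ = 0`, `τ = 1` for the
plain one and `κ = 1`, `τ = 0` for the sandwiched one. -/
def lineSup (ρ : Matrix (A × B × C) (A × B × C) ℂ) (κ τ s : ℝ) : ℝ :=
  (swivelSup ρ ((1 - κ * s) / 2) s ((1 + τ * s) / 2)).toReal

theorem lineSup_zero (hρ : IsDensityOperator ρ) (κ τ : ℝ) : lineSup ρ κ τ 0 = 1 := by
  rw [lineSup, mul_zero, mul_zero, sub_zero, add_zero, swivelSup_zero hρ]

theorem lineSup_interpolation (hρ : IsDensityOperator ρ) {κ : ℝ} (τ : ℝ) (h0 : 0 ≤ κ)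
    (h1 : κ ≤ 1) {x y a b : ℝ} (hx : x ∈ Set.Icc (-1) 1) (hy : y ∈ Set.Icc (-1) 1) (hxy : x < y)
    (ha : 0 < a) (hb : 0 < b) (hab : a + b = 1) :
    lineSup ρ κ τ (a * x + b * y) ≤ lineSup ρ κ τ x ^ a * lineSup ρ κ τ y ^ b := by
  have hc : ∀ s ∈ Set.Icc (-1 : ℝ) 1, 0 ≤ (1 - κ * s) / 2 ∧ (1 - κ * s) / 2 ≤ 1 := fun s hs => by
    have h2 := hs.1
    have h3 := hs.2
    constructor <;> nlinarith
  -- Strictness uses `x < y` and `a > 0`. It keeps the interpolated reciprocal exponent positive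
  -- even when `κ = 1` and `y = 1`, where the endpoint itself is the operator norm.
  have hlt : a * x + b * y < 1 := by nlinarith [hx.2, hy.2]
  have hgt : -1 ≤ a * x + b * y := by nlinarith [hx.1, hy.1]
  have hpos : 0 < (1 - b) * ((1 - κ * x) / 2) + b * ((1 - κ * y) / 2) := by
    have e : (1 - b) * ((1 - κ * x) / 2) + b * ((1 - κ * y) / 2) =
        (1 - κ * (a * x + b * y)) / 2 := by
      rw [show a = 1 - b by linarith]
      ring
    rw [e]
    nlinarith
  have ha' : a = 1 - b := by linarith
  unfold lineSup
  refine swivelSup_toReal_le (by positivity) fun V hV W hW => ?_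
  have h := recipSchattenNorm_chain_interpolation hρ.1 (hc x hx).1 (hc x hx).2 (hc y hy).1
    (hc y hy).2 hb.le (by linarith) hpos
    (fun V hV W hW => recipSchattenNorm_le_swivelSup (hc x hx).1 x ((1 + τ * x) / 2) hV hW)
    (fun V hV W hW => recipSchattenNorm_le_swivelSup (hc y hy).1 y ((1 + τ * y) / 2) hV hW) hV hW
  rw [ha']
  convert h using 2 <;> [ring; (congr 1; ring)]

/-- As `0` is the midpoint of `s` and `-s`, interpolation bounds the value `1` at `0` by the
geometric mean of the values at `±s`; neither can vanish. Hence all logarithms are finite. -/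
theorem lineSup_pos (hρ : IsDensityOperator ρ) {κ : ℝ} (τ : ℝ) (h0 : 0 ≤ κ) (h1 : κ ≤ 1) {s : ℝ}
    (hs : s ∈ Set.Icc (-1) 1) : 0 < lineSup ρ κ τ s := by
  have hnn : 0 ≤ lineSup ρ κ τ s := ENNReal.toReal_nonneg
  refine lt_of_le_of_ne hnn fun h => ?_
  have hs' : -s ∈ Set.Icc (-1 : ℝ) 1 := ⟨by linarith [hs.2], by linarith [hs.1]⟩
  have hz := lineSup_zero hρ κ τ
  rcases lt_trichotomy s 0 with hlt | rfl | hgt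
  · have h2 := lineSup_interpolation hρ τ h0 h1 hs hs' (by linarith) one_half_pos one_half_pos
      (add_halves 1)
    rw [show (1 / 2 * s + 1 / 2 * -s : ℝ) = 0 by ring, hz, ← h, Real.zero_rpow (by norm_num)] at h2
    linarith
  · linarith
  · have h2 := lineSup_interpolation hρ τ h0 h1 hs' hs (by linarith) one_half_pos one_half_pos
      (add_halves 1)
    rw [show (1 / 2 * -s + 1 / 2 * s : ℝ) = 0 by ring, hz, ← h, Real.zero_rpow (by norm_num)] at h2
    linarith

theorem convexOn_log_lineSup (hρ : IsDensityOperator ρ) {κ : ℝ} (τ : ℝ) (h0 : 0 ≤ κ)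
    (h1 : κ ≤ 1) : ConvexOn ℝ (Set.Icc (-1) 1) fun s => Real.log (lineSup ρ κ τ s) := by
  refine LinearOrder.convexOn_of_lt (convex_Icc _ _) fun x hx y hy hxy a b ha hb hab => ?_
  have hpx := lineSup_pos hρ τ h0 h1 hx
  have hpy := lineSup_pos hρ τ h0 h1 hy
  have hp := lineSup_pos hρ τ h0 h1 (convex_Icc (-1 : ℝ) 1 hx hy ha.le hb.le hab)
  simp only [smul_eq_mul] at hp ⊢
  refine (Real.log_le_log hp (lineSup_interpolation hρ τ h0 h1 hx hy hxy ha hb hab)).trans ?_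
  rw [Real.log_mul (by positivity) (by positivity), Real.log_rpow hpx, Real.log_rpow hpy]

/-- Secants from `0` of a convex function vanishing at `0`; the sign of `x` and `y` plays no role.
-/
theorem log_lineSup_div_le (hρ : IsDensityOperator ρ) {κ : ℝ} (τ : ℝ) (h0 : 0 ≤ κ)
    (h1 : κ ≤ 1) {x y : ℝ} (hx : x ∈ Set.Icc (-1) 1) (hy : y ∈ Set.Icc (-1) 1) (hx0 : x ≠ 0)
    (hy0 : y ≠ 0) (hxy : x ≤ y) :
    Real.log (lineSup ρ κ τ x) / x ≤ Real.log (lineSup ρ κ τ y) / y := by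
  have h := (convexOn_log_lineSup hρ τ h0 h1).secant_mono (a := 0) ⟨by norm_num, zero_le_one⟩
    hx hy hx0 hy0 hxy
  simpa only [lineSup_zero hρ, Real.log_one, sub_zero] using h

theorem coe_mul_log_swivelSup (hρ : IsDensityOperator ρ) {κ : ℝ} (τ : ℝ) (h0 : 0 ≤ κ)
    (h1 : κ ≤ 1) {s : ℝ} (hs : s ∈ Set.Icc (-1) 1) :
    ((2 / s : ℝ) : EReal) * ENNReal.log (swivelSup ρ ((1 - κ * s) / 2) s ((1 + τ * s) / 2)) =
      ((2 * (Real.log (lineSup ρ κ τ s) / s) : ℝ) : EReal) := by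
  rw [ENNReal.log_pos_real' (lineSup_pos hρ τ h0 h1 hs), ← EReal.coe_mul, lineSup]
  congr 1
  ring

theorem renyiCMI_eq (hρ : IsDensityOperator ρ) {α : ℝ} (h0 : 0 ≤ α) (h2 : α ≤ 2) :
    renyiCMI ρ α = ((2 * (Real.log (lineSup ρ 0 1 (α - 1)) / (α - 1)) : ℝ) : EReal) := by
  rw [renyiCMI, iSup_logSchattenNorm (by norm_num),
    ← coe_mul_log_swivelSup hρ 1 le_rfl zero_le_one ⟨by linarith, by linarith⟩]
  congr 3
  · simp
  · ring

theorem primeExponent_mem {α : ℝ≥0∞} (hα : 1 / 2 ≤ α) : primeExponent α ∈ Set.Icc (-1 : ℝ) 1 := by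
  unfold primeExponent
  split_ifs with h
  · norm_num
  · have h2 := ENNReal.toReal_mono h hα
    simp only [one_div, ENNReal.toReal_inv, ENNReal.toReal_ofNat] at h2
    have h3 : 0 < α.toReal := by linarith
    constructor
    · rw [le_div_iff₀ h3]
      linarith
    · rw [div_le_one h3]
      linarith

theorem primeExponent_ne_zero {α : ℝ≥0∞} (hα : 1 / 2 ≤ α) (h1 : α ≠ 1) :
    primeExponent α ≠ 0 := by
  unfold primeExponent
  split_ifs with h
  · exact one_ne_zero
  · have h2 : α.toReal ≠ 0 :=
      ENNReal.toReal_ne_zero.2 ⟨fun h0 => by simp [h0] at hα, h⟩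
    refine div_ne_zero (sub_ne_zero.2 fun h3 => h1 ?_) h2
    rw [← ENNReal.ofReal_toReal h, h3, ENNReal.ofReal_one]

theorem primeExponent_mono {α γ : ℝ≥0∞} (hα : 1 / 2 ≤ α) (hαγ : α ≤ γ) :
    primeExponent α ≤ primeExponent γ := by
  by_cases hγ : γ = ∞
  · rw [hγ, show primeExponent ∞ = 1 from if_pos rfl]
    exact (primeExponent_mem hα).2
  · have hα' : α ≠ ∞ := ne_top_of_le_ne_top hγ hαγ
    have h1 := ENNReal.toReal_mono hγ hαγ
    have h2 := ENNReal.toReal_mono hα' hα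
    simp only [one_div, ENNReal.toReal_inv, ENNReal.toReal_ofNat] at h2
    have h3 : 0 < α.toReal := by linarith
    rw [primeExponent, primeExponent, if_neg hα', if_neg hγ, div_le_div_iff₀ h3 (by linarith)]
    nlinarith

/-- From `1 - α' = 1 / α`: the reciprocal Schatten exponent is affine in `α'`, which places the
sandwiched quantity on the line `κ = 1`. -/
theorem toReal_inv_two_mul {α : ℝ≥0∞} (hα : 1 / 2 ≤ α) :
    (2 * α)⁻¹.toReal = (1 - 1 * primeExponent α) / 2 := by
  unfold primeExponent
  split_ifs with h
  · simp [h]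
  · have h2 : α.toReal ≠ 0 :=
      ENNReal.toReal_ne_zero.2 ⟨fun h0 => by simp [h0] at hα, h⟩
    rw [ENNReal.toReal_inv, ENNReal.toReal_mul, ENNReal.toReal_ofNat]
    field_simp
    ring

theorem sandwichedRenyiCMI_eq (hρ : IsDensityOperator ρ) {α : ℝ≥0∞} (hα : 1 / 2 ≤ α) :
    sandwichedRenyiCMI ρ α =
      ((2 * (Real.log (lineSup ρ 1 0 (primeExponent α)) / primeExponent α) : ℝ) : EReal) := by
  have h0 : 2 * α ≠ 0 := mul_ne_zero two_ne_zero fun h0 => by simp [h0] at hα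
  rw [sandwichedRenyiCMI, iSup_logSchattenNorm h0, toReal_inv_two_mul hα,
    ← coe_mul_log_swivelSup hρ 0 zero_le_one le_rfl (primeExponent_mem hα), zero_mul, add_zero]

end Monotonicity

end SwiveledRenyi

end

theorem mainTheorem8 {A B C : Type*} [Fintype A] [Fintype B] [Fintype C]
    [DecidableEq A] [DecidableEq B] [DecidableEq C]
    (ρ : Matrix (A × B × C) (A × B × C) ℂ) (hρ : SwiveledRenyi.IsDensityOperator ρ) :
    (∀ α γ : ℝ, 0 ≤ α → α ≤ γ → γ ≤ 2 → α ≠ 1 → γ ≠ 1 →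
      SwiveledRenyi.renyiCMI ρ α ≤ SwiveledRenyi.renyiCMI ρ γ) ∧
    (∀ α γ : ℝ≥0∞, 1 / 2 ≤ α → α ≤ γ → α ≠ 1 → γ ≠ 1 →
      SwiveledRenyi.sandwichedRenyiCMI ρ α ≤ SwiveledRenyi.sandwichedRenyiCMI ρ γ) := by
  refine ⟨fun α γ h0 hαγ h2 hα hγ => ?_, fun α γ h0 hαγ hα hγ => ?_⟩
  · rw [SwiveledRenyi.renyiCMI_eq hρ h0 (hαγ.trans h2),
      SwiveledRenyi.renyiCMI_eq hρ (h0.trans hαγ) h2, EReal.coe_le_coe_iff]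
    exact mul_le_mul_of_nonneg_left (SwiveledRenyi.log_lineSup_div_le hρ 1 le_rfl zero_le_one
      ⟨by linarith, by linarith⟩ ⟨by linarith, by linarith⟩ (sub_ne_zero.2 hα) (sub_ne_zero.2 hγ)
      (by linarith)) zero_le_two
  · rw [SwiveledRenyi.sandwichedRenyiCMI_eq hρ h0,
      SwiveledRenyi.sandwichedRenyiCMI_eq hρ (h0.trans hαγ), EReal.coe_le_coe_iff]
    exact mul_le_mul_of_nonneg_left (SwiveledRenyi.log_lineSup_div_le hρ 0 zero_le_one le_rfl
      (SwiveledRenyi.primeExponent_mem h0) (SwiveledRenyi.primeExponent_mem (h0.trans hαγ))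
      (SwiveledRenyi.primeExponent_ne_zero h0 hα)
      (SwiveledRenyi.primeExponent_ne_zero (h0.trans hαγ) hγ)
      (SwiveledRenyi.primeExponent_mono h0 hαγ)) zero_le_two
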